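/- **Setting.** Let $l_0\ge 0$, and let $\{\psi_{lk}: l\ge l_0,\ 0\le k<2^{l\vee(l_0+1)}\}$ be an $A$-regular wavelet basis of $L_2[0,1]$ of Cohen–Daubechies–Vial type. That is: it is an orthonormal basis of $L_2[0,1]$; for $l\ge l_0+1$ the functions are $\psi_{lk}(x)=2^{l/2}\psi(2^lx-k)$, except for a fixed number of indices $k$ at each end of the range, where $\psi_{lk}$ is a dyadic rescaling about $0$ or $1$ of one of finitely many boundary functions; at level $l=l_0$ the $2^{l_0+1}$ functions $\psi_{l_0k}=\phi_{l_0+1,k}$ are built in the same way at scale $l_0+1$ from a father wavelet $\phi$ and boundary functions; all generating functions are bounded, measurable and compactly supported; and all $\psi_{lk}$ with $l\ge l_0+1$ have $A$ vanishing moments. Let $c_A$ be the largest number of functions of one level that are nonzero at one point, let $\|\psi\|_\infty=\sup_{l,k,x}2^{-(l\vee(l_0+1))/2}|\psi_{lk}(x)|$, and $c_\psi=2\sqrt2\sqrt{c_A}\,\|\psi\|_\infty$. With $f_{lk}=\langle f,\psi_{lk}\rangle$, the Besov ball $\mathcal B^{\alpha,R}_{p,q}$ is the set of $f\in L_2[0,1]$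 with $$\Big(\sum_{l\ge l_0}\big(2^{l(\alpha+1/2-1/p)}\|(f_{lk})_k\|_{\ell_p}\big)^q\Big)^{1/q}\le R$$ (with a supremum over $l$ if $q=\infty$). Throughout, $R>0$, $\alpha<A$, $2\le p\le\infty$, $1\le q\le\infty$ and $\alpha-1/p>1/2$. Server $j\in\{1,\dots,m\}$ holds $n_j\ge1$ observations $Z^{(j)}=(Y^{(j)}_i,X^{(j)}_i)_{i\le n_j}$ with $Y^{(j)}_i=f(X^{(j)}_i)+\xi^{(j)}_i$, where $X^{(j)}_i\sim U[0,1]$ and $\xi^{(j)}_i\sim N(0,1)$, all independent. Put $N=\sum_jn_j\ge2$ and let $\varepsilon_j>0$, $0<\delta_j\le1$. A randomised transcript $T^{(j)}$ of $Z^{(j)}$ is $(\varepsilon_j,\delta_j)$-differentially private if $\mathbb P(T^{(j)}\in S\mid z)\le e^{\varepsilon_j}\,\mathbb P(T^{(j)}\in S\mid z')+\delta_j$ for all measurable $S$ and all data sets $z,z'$ that differ in at most one observation. **Estimator.** For $L\in\mathbb N$ and $\tau>0$, with $[\cdot]_\tau$ denoting clipping to $[-\tau,\tau]$, server $j$ outputs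 $$T^{(j)}_{lk}=\frac1{n_j}\sum_{i=1}^{n_j}[Y_i^{(j)}]_\tau\,\psi_{lk}(X_i^{(j)})+W^{(j)}_{lk},\qquad l_0\le l\le L,\ 0\le k<2^{l\vee(l_0+1)},$$ where the $W^{(j)}_{lk}$ are independent $N\!\big(0,\ 4\tau^2 2^Lc_\psi^2\log(2/\delta_j)/(n_j^2\varepsilon_j^2)\big)$, and the central server forms $$\hat f_{L,\tau}=\sum_{l=l_0}^L\sum_k\Big(\sum_{j=1}^mu_jT^{(j)}_{lk}\Big)\psi_{lk},\qquad u_j=\frac{v_j}{\sum_iv_i},\quad v_j=(n_j^2\varepsilon_j^2)\wedge(n_j2^L).$$ Let $D>0$ be the solution of $D^{2\alpha+2}=\sum_{j=1}^m(n_j^2\varepsilon_j^2)\wedge(n_jD)$, and take $L=(l_0+1)\vee\lceil\log_2D\rceil$ and $\tau=C_{\alpha,R}+\sqrt{(2\alpha+1)L}$, where $C_{\alpha,R}>0$ is any constant with $\|f\|_\infty\le C_{\alpha,R}$ for all $f\in\mathcal B^{\alpha,R}_{p,q}$. **Theorem.** (0) A constant $C_{\alpha,R}$ as required exists, and can be chosen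 to depend only on the wavelet basis, $\alpha$ and $R$. (1) For every $j$ with $\varepsilon_j\le2\log(2/\delta_j)$, the transcript $T^{(j)}$ is $(\varepsilon_j,\delta_j)$-differentially private. Hence, if this holds for all $j$, $\hat f_{L,\tau}$ is a distributed $(\boldsymbol\varepsilon,\boldsymbol\delta)$-DP protocol. (2) For every $\kappa>0$ there is a constant $C>0$, depending only on the wavelet basis, $\alpha$, $R$, $C_{\alpha,R}$ and $\kappa$ (and not on $p,q,m,n_j,\varepsilon_j,\delta_j$), such that whenever $D\ge\kappa$, $$\sup_{f\in\mathcal B^{\alpha,R}_{p,q}}\mathbb E_f\big\|\hat f_{L,\tau}-f\big\|_2^2\le C\,\log(N)\,\log(2/\delta')\,2^{-2L\alpha},\qquad \delta'=\min_j\delta_j .$$ -/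

import Mathlib

open MeasureTheory ProbabilityTheory
open scoped ENNReal NNReal

noncomputable section

namespace FedWavelet

/-! ### Compactly supported wavelet bases of the unit interval -/

/-- A bounded, measurable, compactly supported function on the line. -/
structure IsGenerator (g : ℝ → ℝ) : Prop where
  measurable : Measurable g
  bounded : ∃ b : ℝ, ∀ x, |g x| ≤ b
  compact : HasCompactSupport g

/-- Number of basis functions at level `l`. For `l = l₀` these are the father wavelets of
resolution `l₀ + 1` (there are `2 ^ (l₀ + 1)` of them), for `l ≥ l₀ + 1` the `2 ^ l` mother
wavelets. In both cases the number is `2 ^ s` where `s = max l (l₀ + 1)` is the actual dyadic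
scale of the functions. -/
def width (l₀ l : ℕ) : ℕ := 2 ^ max l (l₀ + 1)

/-- The generating functions of a wavelet system on `[0, 1]` of the Cohen-Daubechies-Vial type:
a father and a mother wavelet, and, at each of the two endpoints, `edge` boundary-adapted father
wavelets and `edge` boundary-adapted mother wavelets (only the indices `k < edge` are used). -/
structure WaveletSystem (l₀ : ℕ) where
  father : ℝ → ℝ
  mother : ℝ → ℝ
  edge : ℕ
  fatherLeft : ℕ → ℝ → ℝ
  fatherRight : ℕ → ℝ → ℝ
  motherLeft : ℕ → ℝ → ℝ
  motherRight : ℕ → ℝ → ℝ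
  two_edge_le : 2 * edge ≤ 2 ^ (l₀ + 1)
  father_gen : IsGenerator father
  mother_gen : IsGenerator mother
  fatherLeft_gen : ∀ k, IsGenerator (fatherLeft k)
  fatherRight_gen : ∀ k, IsGenerator (fatherRight k)
  motherLeft_gen : ∀ k, IsGenerator (motherLeft k)
  motherRight_gen : ∀ k, IsGenerator (motherRight k)

/-- The `k`-th function of scale `s` generated by an interior function `g` and `e` boundary
functions on each side: `2 ^ (s / 2) * g (2 ^ s * x - k)` in the interior, and a dyadic rescaling
of a boundary function (around `0` or around `1`) for the first `e` and the last `e` indices. -/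
def dilate (e : ℕ) (g : ℝ → ℝ) (gl gr : ℕ → ℝ → ℝ) (s k : ℕ) (x : ℝ) : ℝ :=
  (2 : ℝ) ^ ((s : ℝ) / 2) *
    (if k < e then gl k (2 ^ s * x)
     else if k + e < 2 ^ s then g (2 ^ s * x - k)
     else gr (2 ^ s - 1 - k) (2 ^ s * (1 - x)))

lemma measurable_dilate {e : ℕ} {g : ℝ → ℝ} {gl gr : ℕ → ℝ → ℝ} (hg : IsGenerator g)
    (hl : ∀ k, IsGenerator (gl k)) (hr : ∀ k, IsGenerator (gr k)) (s k : ℕ) :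
    Measurable (dilate e g gl gr s k) := by
  unfold dilate
  refine measurable_const.mul ?_
  split_ifs
  · exact (hl k).measurable.comp (by fun_prop)
  · exact hg.measurable.comp (by fun_prop)
  · exact (hr _).measurable.comp (by fun_prop)

namespace WaveletSystem

variable {l₀ : ℕ} (W : WaveletSystem l₀)

/-- The basis functions `ψ_{lk}` on `[0, 1]`, for `l ≥ l₀` and `k < width l₀ l`; at the lowest
level `ψ_{l₀ k}` is the father wavelet `φ_{l₀ + 1, k}`. -/
def psi (l k : ℕ) (x : unitInterval) : ℝ :=
  if l ≤ l₀ then dilate W.edge W.father W.fatherLeft W.fatherRight (l₀ + 1) k x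
  else dilate W.edge W.mother W.motherLeft W.motherRight l k x

lemma measurable_psi (l k : ℕ) : Measurable (W.psi l k) := by
  unfold psi
  split_ifs
  · exact (measurable_dilate W.father_gen W.fatherLeft_gen W.fatherRight_gen _ _).comp
      measurable_subtype_coe
  · exact (measurable_dilate W.mother_gen W.motherLeft_gen W.motherRight_gen _ _).comp
      measurable_subtype_coe

/-- Wavelet coefficient `f_{lk} = ⟨f, ψ_{lk}⟩` in `L₂[0, 1]`. -/
def coef (f : unitInterval → ℝ) (l k : ℕ) : ℝ := ∫ x, f x * W.psi l k x

/-- The system is an orthonormal basis of `L₂[0, 1]` that is `A`-regular: all mother wavelets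
have `A` vanishing moments. -/
structure IsRegularBasis (A : ℕ) : Prop where
  orthonormal : ∀ l l' k k' : ℕ, l₀ ≤ l → l₀ ≤ l' → k < width l₀ l → k' < width l₀ l' →
    ∫ x, W.psi l k x * W.psi l' k' x = if l = l' ∧ k = k' then 1 else 0
  complete : ∀ f : unitInterval → ℝ, MemLp f 2 volume →
    (∀ l k : ℕ, l₀ ≤ l → k < width l₀ l → W.coef f l k = 0) → f =ᵐ[volume] 0
  vanishing : ∀ l k r : ℕ, l₀ < l → k < width l₀ l → r < A →
    ∫ x : unitInterval, (x : ℝ) ^ r * W.psi l k x = 0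

/-- `‖ψ‖_∞`: the supremum of all the basis functions, each normalised by its scale. -/
def supNorm : ℝ :=
  sSup {b : ℝ | ∃ l k : ℕ, ∃ x : unitInterval, l₀ ≤ l ∧ k < width l₀ l ∧
    b = |W.psi l k x| / (2 : ℝ) ^ (((max l (l₀ + 1) : ℕ) : ℝ) / 2)}

/-- The supremum in `supNorm` is over a bounded set. -/
lemma bddAbove_supNorm : BddAbove {b : ℝ | ∃ l k : ℕ, ∃ x : unitInterval, l₀ ≤ l ∧
    k < width l₀ l ∧ b = |W.psi l k x| / (2 : ℝ) ^ (((max l (l₀ + 1) : ℕ) : ℝ) / 2)} := by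
  have key : ∀ (e : ℕ) (g : ℝ → ℝ) (gl gr : ℕ → ℝ → ℝ), IsGenerator g →
      (∀ k, IsGenerator (gl k)) → (∀ k, IsGenerator (gr k)) →
      ∃ b : ℝ, ∀ (s k : ℕ) (x : ℝ), k < 2 ^ s →
        |dilate e g gl gr s k x| / (2 : ℝ) ^ ((s : ℝ) / 2) ≤ b := by
    intro e g gl gr hg hl hr
    obtain ⟨b, hb⟩ := hg.bounded
    choose bl hbl using fun k => (hl k).bounded
    choose br hbr using fun k => (hr k).bounded
    have hl0 : ∀ k, 0 ≤ bl k := fun k => (abs_nonneg _).trans (hbl k 0)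
    have hr0 : ∀ k, 0 ≤ br k := fun k => (abs_nonneg _).trans (hbr k 0)
    have h0 : 0 ≤ b := (abs_nonneg _).trans (hb 0)
    have hsl := Finset.sum_nonneg fun k (_ : k ∈ Finset.range e) => hl0 k
    have hsr := Finset.sum_nonneg fun k (_ : k ∈ Finset.range e) => hr0 k
    refine ⟨b + ∑ k ∈ Finset.range e, bl k + ∑ k ∈ Finset.range e, br k, fun s k x hk => ?_⟩
    have hp : (0 : ℝ) < (2 : ℝ) ^ ((s : ℝ) / 2) := by positivity
    rw [dilate, abs_mul, abs_of_pos hp, mul_div_cancel_left₀ _ hp.ne']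
    split_ifs with h1 h2
    · have := Finset.single_le_sum (fun k _ => hl0 k) (Finset.mem_range.2 h1)
      linarith [hbl k (2 ^ s * x)]
    · linarith [hb (2 ^ s * x - k)]
    · have h3 : 2 ^ s - 1 - k < e := by omega
      have := Finset.single_le_sum (fun k _ => hr0 k) (Finset.mem_range.2 h3)
      linarith [hbr (2 ^ s - 1 - k) (2 ^ s * (1 - x))]
  obtain ⟨b1, h1⟩ := key W.edge _ _ _ W.father_gen W.fatherLeft_gen W.fatherRight_gen
  obtain ⟨b2, h2⟩ := key W.edge _ _ _ W.mother_gen W.motherLeft_gen W.motherRight_gen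
  refine ⟨max b1 b2, ?_⟩
  rintro _ ⟨l, k, x, -, hk, rfl⟩
  unfold width at hk
  unfold psi
  split_ifs with h
  · rw [max_eq_right (by omega)] at hk ⊢
    exact (h1 _ _ _ hk).trans (le_max_left _ _)
  · rw [max_eq_left (by omega)] at hk ⊢
    exact (h2 _ _ _ hk).trans (le_max_right _ _)

open Classical in
/-- `c_A`: the largest number of basis functions of one level that are nonzero at one point. -/
def overlap : ℕ :=
  sSup {c : ℕ | ∃ l : ℕ, ∃ x : unitInterval, l₀ ≤ l ∧
    c = ((Finset.range (width l₀ l)).filter fun k => W.psi l k x ≠ 0).card}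

open Classical in
/-- The supremum in `overlap` is over a bounded set. -/
lemma bddAbove_overlap : BddAbove {c : ℕ | ∃ l : ℕ, ∃ x : unitInterval, l₀ ≤ l ∧
    c = ((Finset.range (width l₀ l)).filter fun k => W.psi l k x ≠ 0).card} := by
  have key : ∀ (e : ℕ) (g : ℝ → ℝ) (gl gr : ℕ → ℝ → ℝ), IsGenerator g → ∃ c : ℕ, ∀ (s : ℕ) (x : ℝ),
      ((Finset.range (2 ^ s)).filter fun k => dilate e g gl gr s k x ≠ 0).card ≤ c := by
    intro e g gl gr hg
    obtain ⟨r, hr⟩ := hg.compact.isCompact.isBounded.subset_closedBall (0 : ℝ)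
    obtain ⟨S, hS⟩ := exists_nat_ge r
    have hsupp : ∀ y, g y ≠ 0 → |y| ≤ S := fun y hy => by
      have := hr (subset_tsupport g hy)
      rw [mem_closedBall_zero_iff, Real.norm_eq_abs] at this
      exact this.trans hS
    refine ⟨e + e + (2 * S + 1), fun s x => ?_⟩
    set y : ℝ := 2 ^ s * x
    have hsub : ((Finset.range (2 ^ s)).filter fun k => dilate e g gl gr s k x ≠ 0) ⊆
        Finset.range e ∪ (Finset.range e).image (fun i => 2 ^ s - 1 - i) ∪
          Finset.Icc ⌈y - S⌉₊ (⌈y - S⌉₊ + 2 * S) := by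
      intro k hk
      rw [Finset.mem_filter, Finset.mem_range] at hk
      obtain ⟨hk, hne⟩ := hk
      simp only [Finset.mem_union, Finset.mem_range, Finset.mem_image, Finset.mem_Icc]
      by_cases h1 : k < e
      · exact Or.inl (Or.inl h1)
      by_cases h2 : k + e < 2 ^ s
      · right
        have hg0 : g (y - k) ≠ 0 := by
          intro h
          exact hne (by simp [dilate, h1, h2, y, h] at *)
        have hb := abs_le.1 (hsupp _ hg0)
        refine ⟨Nat.ceil_le.2 (by linarith), ?_⟩
        have h3 := Nat.le_ceil (y - S)
        have h4 : (k : ℝ) ≤ ((⌈y - S⌉₊ + 2 * S : ℕ) : ℝ) := by push_cast; linarith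
        exact_mod_cast h4
      · exact Or.inl (Or.inr ⟨2 ^ s - 1 - k, by omega, by omega⟩)
    refine (Finset.card_le_card hsub).trans ((Finset.card_union_le _ _).trans ?_)
    have h5 := Finset.card_union_le (Finset.range e)
      ((Finset.range e).image (fun i => 2 ^ s - 1 - i))
    have h6 := Finset.card_image_le (s := Finset.range e) (f := fun i => 2 ^ s - 1 - i)
    rw [Finset.card_range] at h5 h6
    rw [Nat.card_Icc]
    omega
  obtain ⟨c1, h1⟩ := key W.edge _ W.fatherLeft W.fatherRight W.father_gen
  obtain ⟨c2, h2⟩ := key W.edge _ W.motherLeft W.motherRight W.mother_gen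
  refine ⟨max c1 c2, ?_⟩
  rintro _ ⟨l, x, -, rfl⟩
  by_cases h : l ≤ l₀
  · simp only [psi, h, if_true, width, max_eq_right (show l ≤ l₀ + 1 by omega)]
    exact (h1 _ _).trans (le_max_left _ _)
  · simp only [psi, h, if_false, width, max_eq_left (show l₀ + 1 ≤ l by omega)]
    exact (h2 _ _).trans (le_max_right _ _)

/-- `c_ψ = 2 √2 √c_A ‖ψ‖_∞`. -/
def cPsi : ℝ := 2 * Real.sqrt 2 * Real.sqrt W.overlap * W.supNorm

/-! ### Besov balls -/

/-- The `ℓ_p` norm of the wavelet coefficients of level `l`, for `p ∈ [1, ∞]`. -/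
def levelNorm (p : ℝ≥0∞) (f : unitInterval → ℝ) (l : ℕ) : ℝ≥0∞ :=
  if p = ∞ then ⨆ k ∈ Finset.range (width l₀ l), ENNReal.ofReal |W.coef f l k|
  else (∑ k ∈ Finset.range (width l₀ l), ENNReal.ofReal |W.coef f l k| ^ p.toReal) ^ (1 / p.toReal)

/-- The `l`-th term `2 ^ (l (α + 1/2 - 1/p)) ‖(f_{lk})_k‖_p` of the Besov norm. -/
def besovTerm (α : ℝ) (p : ℝ≥0∞) (f : unitInterval → ℝ) (l : ℕ) : ℝ≥0∞ :=
  ENNReal.ofReal ((2 : ℝ) ^ ((l : ℝ) * (α + 1 / 2 - (p⁻¹).toReal))) * W.levelNorm p f l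

/-- The Besov norm (with values in `[0, ∞]`); the levels are `l = l₀ + i`, `i = 0, 1, 2, …`. -/
def besovNorm (α : ℝ) (p q : ℝ≥0∞) (f : unitInterval → ℝ) : ℝ≥0∞ :=
  if q = ∞ then ⨆ i : ℕ, W.besovTerm α p f (l₀ + i)
  else (∑' i : ℕ, W.besovTerm α p f (l₀ + i) ^ q.toReal) ^ (1 / q.toReal)

/-- The closed Besov ball of radius `R`. -/
def besovBall (α : ℝ) (p q : ℝ≥0∞) (R : ℝ) : Set (unitInterval → ℝ) :=
  {f | MemLp f 2 volume ∧ W.besovNorm α p q f ≤ ENNReal.ofReal R}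

end WaveletSystem

/-! ### Data and differential privacy -/

/-- One observation `(Y, X)`. -/
abbrev Obs : Type := ℝ × unitInterval

/-- The law `P_f` of one observation: `Y = f(X) + ξ`, `X ∼ U[0, 1]` and `ξ ∼ N(0, 1)`
independent. -/
def obsLaw (f : unitInterval → ℝ) : Measure Obs :=
  ((volume : Measure unitInterval).prod (gaussianReal 0 1)).map fun w => (f w.1 + w.2, w.1)

/-- The joint law of all the data: independent observations with law `P_f`, of which server `j`
holds `n j`. -/
def dataLaw {m : ℕ} (n : Fin m → ℕ) (f : unitInterval → ℝ) :
    Measure ((j : Fin m) → Fin (n j) → Obs) :=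
  Measure.pi fun j => Measure.pi fun _ : Fin (n j) => obsLaw f

open Classical in
/-- `(ε, δ)`-differential privacy of a randomised transcript computed from a data set of size `n`:
neighbouring data sets have Hamming distance at most one. -/
def IsDP {n : ℕ} {T : Type*} [MeasurableSpace T] (κ : Kernel (Fin n → Obs) T) (ε δ : ℝ) : Prop :=
  ∀ z z' : Fin n → Obs, hammingDist z z' ≤ 1 → ∀ S : Set T, MeasurableSet S →
    κ z S ≤ ENNReal.ofReal (Real.exp ε) * κ z' S + ENNReal.ofReal δ

/-- Clipping of `x` at the threshold `τ`. -/
def clip (τ x : ℝ) : ℝ := max (-τ) (min x τ)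

lemma measurable_clip (τ : ℝ) : Measurable (clip τ) := by
  unfold clip; fun_prop

/-- The pairs `(l, k)` with `l₀ ≤ l ≤ L` and `k < width l₀ l`. -/
def indices (l₀ L : ℕ) : Finset ((_ : ℕ) × ℕ) :=
  (Finset.Icc l₀ L).sigma fun l => Finset.range (width l₀ l)

/-- The space of the transcript of one server: one real number for each `(l, k)`. -/
abbrev Transcript (l₀ L : ℕ) : Type := indices l₀ L → ℝ

/-- The noise vector: independent centred Gaussian coordinates with variance `v`. -/
def noise (l₀ L : ℕ) (v : ℝ≥0) : Measure (Transcript l₀ L) := Measure.pi fun _ => gaussianReal 0 v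

instance (l₀ L : ℕ) (v : ℝ≥0) : IsProbabilityMeasure (noise l₀ L v) := by
  unfold noise; infer_instance

namespace WaveletSystem

variable {l₀ : ℕ} (W : WaveletSystem l₀)

/-- The clipped empirical wavelet coefficients of one server with `n` observations. -/
def empCoef (L : ℕ) (τ : ℝ) {n : ℕ} (z : Fin n → Obs) : Transcript l₀ L := fun a =>
  (1 / (n : ℝ)) * ∑ i, clip τ (z i).1 * W.psi a.1.1 a.1.2 (z i).2

lemma measurable_empCoef (L : ℕ) (τ : ℝ) (n : ℕ) :
    Measurable (W.empCoef L τ : (Fin n → Obs) → Transcript l₀ L) := by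
  unfold empCoef
  refine measurable_pi_lambda _ fun a => measurable_const.mul (Finset.measurable_sum _ fun i _ => ?_)
  exact ((measurable_clip τ).comp ((measurable_pi_apply i).fst)).mul
    ((W.measurable_psi _ _).comp ((measurable_pi_apply i).snd))

/-- The variance of the privacy noise of a server with `n` observations and budget `(ε, δ)`. -/
def noiseVar (L : ℕ) (τ : ℝ) (n : ℕ) (ε δ : ℝ) : ℝ≥0 :=
  Real.toNNReal (4 * τ ^ 2 * 2 ^ L * W.cPsi ^ 2 * Real.log (2 / δ) / ((n : ℝ) ^ 2 * ε ^ 2))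

/-- The randomised transcript of one server: the Markov kernel that maps the data `z` to the law
of the empirical coefficients of `z` plus the Gaussian noise vector. -/
def transcript (L : ℕ) (τ : ℝ) (n : ℕ) (ε δ : ℝ) : Kernel (Fin n → Obs) (Transcript l₀ L) where
  toFun z := (noise l₀ L (W.noiseVar L τ n ε δ)).map fun w => W.empCoef L τ z + w
  measurable' := by
    refine Measure.measurable_of_measurable_coe _ fun S hS => ?_
    have hm : Measurable fun p : (Fin n → Obs) × Transcript l₀ L => W.empCoef L τ p.1 + p.2 :=
      ((W.measurable_empCoef L τ n).comp measurable_fst).add measurable_snd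
    have h : ∀ z : Fin n → Obs,
        (noise l₀ L (W.noiseVar L τ n ε δ)).map (fun w => W.empCoef L τ z + w) S =
          noise l₀ L (W.noiseVar L τ n ε δ)
            (Prod.mk z ⁻¹' ((fun p : (Fin n → Obs) × Transcript l₀ L =>
              W.empCoef L τ p.1 + p.2) ⁻¹' S)) := by
      intro z
      rw [Measure.map_apply (by fun_prop) hS]
      rfl
    simp_rw [h]
    exact measurable_measure_prodMk_left (hm hS)

instance (L : ℕ) (τ : ℝ) (n : ℕ) (ε δ : ℝ) : IsMarkovKernel (W.transcript L τ n ε δ) where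
  isProbabilityMeasure z := Measure.isProbabilityMeasure_map
    (μ := noise l₀ L (W.noiseVar L τ n ε δ)) (f := fun w => W.empCoef L τ z + w) (by fun_prop)

/-- `v_j = (n_j² ε_j²) ∧ (n_j 2 ^ L)`. -/
def rawWeight (L n : ℕ) (ε : ℝ) : ℝ := min ((n : ℝ) ^ 2 * ε ^ 2) ((n : ℝ) * 2 ^ L)

/-- The central estimator, a function of the transcripts: the weights are
`u_j = v_j / ∑_i v_i`. -/
def estimator (L : ℕ) {m : ℕ} (n : Fin m → ℕ) (ε : Fin m → ℝ) (t : Fin m → Transcript l₀ L)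
    (x : unitInterval) : ℝ :=
  ∑ a : indices l₀ L,
    (∑ j, rawWeight L (n j) (ε j) / (∑ i, rawWeight L (n i) (ε i)) * t j a) * W.psi a.1.1 a.1.2 x

/-- The `L₂`-risk `E_f ‖f̂ - f‖₂²`; the expectation is over the data and, given the data, over the
independent transcripts of the servers. -/
def risk (L : ℕ) (τ : ℝ) {m : ℕ} (n : Fin m → ℕ) (ε δ : Fin m → ℝ) (f : unitInterval → ℝ) :
    ℝ≥0∞ :=
  ∫⁻ z, ∫⁻ t, ∫⁻ x, ENNReal.ofReal ((W.estimator L n ε t x - f x) ^ 2) ∂volume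
    ∂(Measure.pi fun j => W.transcript L τ (n j) (ε j) (δ j) (z j)) ∂(dataLaw n f)

end WaveletSystem

/-- The resolution level `L = (l₀ + 1) ∨ ⌈log₂ D⌉`. -/
def level (l₀ : ℕ) (D : ℝ) : ℕ := max (l₀ + 1) ⌈Real.logb 2 D⌉₊

/-- The clipping threshold `τ = c + √((2 α + 1) L)`. -/
def threshold (c α : ℝ) (L : ℕ) : ℝ := c + Real.sqrt ((2 * α + 1) * L)

end FedWavelet

end

/-!
Why the federated wavelet estimator is private and attains the rate `2^(-2Lα)` up to logarithms.

*Sup-norm bound.* On a Besov ball with `α - 1/p > 1/2` the coefficients of level `l` are at most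
`R 2⁻ˡ` (`abs_coef_le_half_pow`), while at each point only boundedly many functions of size `2^(l/2)`
are active. The wavelet series is thus dominated by a geometric series; its sum has the coefficients
of `f`, so it equals `f` almost everywhere by completeness of the basis (`ae_hasSum_levelPart`,
`ae_abs_le_of_coef_le`). None of the constants involves `p` or `q`.

*Privacy.* Changing one observation moves the vector of clipped empirical coefficients by at most
`Δ = τ 2^(L/2) c_ψ / n` in `ℓ₂` (`sum_empCoef_sub_sq_le`), and the noise variance is
`4 Δ² log (2/δ) / ε²`. By the Cameron-Martin formula the privacy loss is Gaussian, and a Chernoff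
bound shows that it exceeds `ε` with probability at most `δ` (`gaussian_mechanism`).

*Risk.* By orthonormality the squared loss is, up to a factor `2`, the squared error in the
`2^(L+1)` coefficients of levels `l ≤ L` plus the squared approximation error, which is at most
`R² 2^(-2Lα)`: by the power mean inequality each level `l > L` carries energy `R² 2^(-2lα)`
(`sum_coef_sq_le`, `lintegral_sub_proj_sq_le`). The error in one coefficient has three sources
(`risk_le`): the privacy noise, the sampling variance of the clipped products, and the clipping bias,
at most `2 exp (-(τ - c)²/2)` (`abs_integral_clippedProd_sub_coef_le`), for which the choice of `τ`
is made. With weights proportional to `v_j` the two variances, summed over the coefficients, are of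
order `τ² log (2/δ') 2^(2L) / ∑ v_j`. Since `2^L` is of the order of `D`, the equation defining `D`
turns `2^(2L) / ∑ v_j` into `2^(-2Lα)` (`two_pow_div_sum_rawWeight_le`). It also gives
`D^(2α+2) ≤ N D`, so that `τ²`, which is of the order of `L`, is at most of the order of `log N`
(`level_le`).
-/

namespace FedWavelet

/-! ### The Gaussian mechanism -/

/-- The likelihood ratio of two Gaussian laws of equal variance. -/
lemma gaussianReal_eq_withDensity (d : ℝ) {v : ℝ≥0} (hv : v ≠ 0) :
    gaussianReal d v = (gaussianReal 0 v).withDensity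
      fun y => ENNReal.ofReal (Real.exp (d * y / v - d ^ 2 / (2 * v))) := by
  have hv' : (v : ℝ) ≠ 0 := by exact_mod_cast hv
  rw [gaussianReal_of_var_ne_zero d hv, gaussianReal_of_var_ne_zero 0 hv,
    ← withDensity_mul _ (measurable_gaussianPDF _ _) (by fun_prop)]
  congr 1
  ext y
  simp only [Pi.mul_apply, gaussianPDF, gaussianPDFReal]
  rw [← ENNReal.ofReal_mul (by positivity), mul_assoc _ (Real.exp _), ← Real.exp_add]
  congr 3
  field_simp
  ring

/-- The Cameron-Martin formula for a product of centred Gaussian measures. -/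
lemma pi_gaussianReal_map_add {ι : Type*} [Fintype ι] (d : ι → ℝ) {v : ℝ≥0} (hv : v ≠ 0) :
    (Measure.pi fun _ : ι => gaussianReal 0 v).map (fun w => d + w) =
      (Measure.pi fun _ : ι => gaussianReal 0 v).withDensity fun w =>
        ENNReal.ofReal (Real.exp ((∑ i, d i * w i) / v - (∑ i, d i ^ 2) / (2 * v))) := by
  have h1 : (Measure.pi fun _ : ι => gaussianReal 0 v).map (fun w => d + w) =
      Measure.pi fun i => gaussianReal (d i) v := by
    have := Measure.pi_map_pi (μ := fun _ : ι => gaussianReal 0 v)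
      (f := fun i x => d i + x) (fun i => by fun_prop)
    simp only [gaussianReal_map_const_add, zero_add] at this
    exact this
  rw [h1]
  refine Measure.pi_eq fun s hs => ?_
  set q : ι → ℝ → ℝ := fun i y => Real.exp (d i * y / v - d i ^ 2 / (2 * v)) with hq
  have hqm : ∀ i, Measurable (q i) := fun i => by simp only [hq]; fun_prop
  have hqi : ∀ i, Integrable (q i) (gaussianReal 0 v) := fun i => by
    have := (integrable_exp_mul_gaussianReal (μ := 0) (v := v) (d i / v)).mul_const
      (Real.exp (-(d i ^ 2 / (2 * v))))
    refine this.congr (.of_forall fun y => ?_)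
    simp only [hq]
    rw [← Real.exp_add]
    congr 1; ring
  have hsi : ∀ i, Integrable ((s i).indicator (q i)) (gaussianReal 0 v) :=
    fun i => (hqi i).indicator (hs i)
  have hs0 : ∀ i y, 0 ≤ (s i).indicator (q i) y :=
    fun i y => Set.indicator_nonneg (fun _ _ => (Real.exp_pos _).le) y
  have h2 : ∀ i, gaussianReal (d i) v (s i) =
      ENNReal.ofReal (∫ y, (s i).indicator (q i) y ∂gaussianReal 0 v) := fun i => by
    rw [gaussianReal_eq_withDensity (d i) hv, withDensity_apply _ (hs i),
      ← lintegral_indicator (hs i),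
      ofReal_integral_eq_lintegral_ofReal (hsi i) (.of_forall (hs0 i))]
    refine lintegral_congr fun y => ?_
    by_cases hy : y ∈ s i <;> simp [hy, hq]
  simp_rw [h2]
  rw [← ENNReal.ofReal_prod_of_nonneg fun i _ => integral_nonneg (hs0 i),
    ← integral_fintype_prod_eq_prod,
    withDensity_apply _ (MeasurableSet.univ_pi hs), ← lintegral_indicator (MeasurableSet.univ_pi hs),
    ofReal_integral_eq_lintegral_ofReal (Integrable.fintype_prod hsi)
      (.of_forall fun w => Finset.prod_nonneg fun i _ => hs0 i _)]
  refine lintegral_congr fun w => ?_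
  by_cases hw : w ∈ Set.univ.pi s
  · have hw' : ∀ i, w i ∈ s i := fun i => hw i trivial
    simp only [hw, hw', Set.indicator_of_mem, hq]
    rw [← Real.exp_sum, Finset.sum_sub_distrib, Finset.sum_div, Finset.sum_div]
  · have : ∃ i, w i ∉ s i := by simpa [Set.mem_pi] using hw
    obtain ⟨i, hi⟩ := this
    rw [Set.indicator_of_notMem hw, Finset.prod_eq_zero (Finset.mem_univ i)
      (Set.indicator_of_notMem hi _), ENNReal.ofReal_zero]

lemma hasSubgaussianMGF_gaussianReal (v : ℝ≥0) :
    HasSubgaussianMGF (fun x => x) v (gaussianReal 0 v) where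
  integrable_exp_mul t := integrable_exp_mul_gaussianReal t
  mgf_le t := by rw [mgf_fun_id_gaussianReal]; simp

/-- Chernoff bound for a linear functional of Gaussian white noise. -/
lemma pi_gaussianReal_tail {ι : Type*} [Fintype ι] (d : ι → ℝ) (v : ℝ≥0) {t : ℝ} (ht : 0 ≤ t) :
    (Measure.pi fun _ : ι => gaussianReal 0 v) {w | t ≤ ∑ i, d i * w i} ≤
      ENNReal.ofReal (Real.exp (-t ^ 2 / (2 * (v * ∑ i, d i ^ 2)))) := by
  have hind : iIndepFun (fun i (w : ι → ℝ) => d i * w i) (Measure.pi fun _ : ι => gaussianReal 0 v) :=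
    iIndepFun_pi (X := fun i x => d i * x) fun i => by fun_prop
  have hsub : ∀ i ∈ Finset.univ, HasSubgaussianMGF (fun w : ι → ℝ => d i * w i)
      (⟨d i ^ 2, sq_nonneg _⟩ * v) (Measure.pi fun _ : ι => gaussianReal 0 v) := fun i _ => by
    have h := (hasSubgaussianMGF_gaussianReal v).const_mul (d i)
    rw [← (measurePreserving_eval (fun _ : ι => gaussianReal 0 v) i).map_eq] at h
    exact h.of_map (measurable_pi_apply i).aemeasurable
  have h := HasSubgaussianMGF.measure_sum_ge_le_of_iIndepFun hind hsub ht
  rw [ENNReal.le_ofReal_iff_toReal_le (measure_ne_top _ _) (Real.exp_pos _).le]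
  refine h.trans_eq ?_
  congr 3
  push_cast
  rw [Finset.mul_sum]
  congr 1
  funext i
  rw [mul_comm]; rfl

/-- The Gaussian mechanism is differentially private: two translates of Gaussian white noise of
variance `v`, at distance at most `Δ` with `4 Δ² log (2 / δ) ≤ v ε²`, are `(ε, δ)`-close. -/
lemma gaussian_mechanism {ι : Type*} [Fintype ι] (a b : ι → ℝ) (v : ℝ≥0) {ε δ : ℝ}
    (hε : 0 < ε) (hδ : 0 < δ) (hδ1 : δ ≤ 1) (hεδ : ε ≤ 2 * Real.log (2 / δ))
    (hv : 4 * (∑ i, (a i - b i) ^ 2) * Real.log (2 / δ) ≤ v * ε ^ 2)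
    {S : Set (ι → ℝ)} (hS : MeasurableSet S) :
    (Measure.pi fun _ : ι => gaussianReal 0 v).map (fun w => a + w) S ≤
      ENNReal.ofReal (Real.exp ε) *
        (Measure.pi fun _ : ι => gaussianReal 0 v).map (fun w => b + w) S + ENNReal.ofReal δ := by
  set μ := Measure.pi fun _ : ι => gaussianReal 0 v with hμ
  set ℓ := Real.log (2 / δ) with hℓ
  have hℓ0 : 0 < ℓ := Real.log_pos (by rw [lt_div_iff₀ hδ]; linarith)
  set d : ι → ℝ := a - b with hd
  set Q := ∑ i, d i ^ 2 with hQ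
  have hQ0 : 0 ≤ Q := Finset.sum_nonneg fun i _ => sq_nonneg _
  change 4 * Q * ℓ ≤ v * ε ^ 2 at hv
  rcases hQ0.eq_or_lt with hQz | hQpos
  · have hab : a = b := by
      funext i
      have := (Finset.sum_eq_zero_iff_of_nonneg fun i _ => sq_nonneg (d i)).1 hQz.symm i
        (Finset.mem_univ i)
      have h3 : d i = 0 := by simpa using this
      exact sub_eq_zero.1 h3
    rw [hab]
    refine le_add_right (le_mul_of_one_le_left (zero_le) ?_)
    rw [ENNReal.one_le_ofReal]
    exact Real.one_le_exp hε.le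
  have hvpos : (0 : ℝ) < v := by
    by_contra! h
    have : (v : ℝ) = 0 := le_antisymm h v.2
    rw [this, zero_mul] at hv
    nlinarith [mul_pos hQpos hℓ0]
  have hv0 : v ≠ 0 := by rintro rfl; simp at hvpos
  set S' : Set (ι → ℝ) := (fun w => b + w) ⁻¹' S with hS'
  have hS'm : MeasurableSet S' := (by fun_prop : Measurable fun w : ι → ℝ => b + w) hS
  have hA : μ.map (fun w => a + w) S = μ.map (fun w => d + w) S' := by
    rw [Measure.map_apply (by fun_prop) hS, Measure.map_apply (by fun_prop) hS'm, hS',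
      ← Set.preimage_comp]
    congr 2
    funext w
    simp only [Function.comp, hd]
    abel
  have hB : μ.map (fun w => b + w) S = μ S' := Measure.map_apply (by fun_prop) hS
  rw [hA, hB]
  set r : (ι → ℝ) → ℝ := fun w => (∑ i, d i * w i) / v - Q / (2 * v) with hr
  have hrm : Measurable r := by simp only [hr]; fun_prop
  have hcm := pi_gaussianReal_map_add d hv0
  rw [← hμ, ← hQ] at hcm
  -- the event on which the privacy loss `r` is at most `ε`
  set E : Set (ι → ℝ) := {w | r w ≤ ε} with hE
  have hEm : MeasurableSet E := hrm measurableSet_Iic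
  have h1 : μ.map (fun w => d + w) (S' ∩ E) ≤ ENNReal.ofReal (Real.exp ε) * μ S' := by
    rw [hcm, withDensity_apply _ (hS'm.inter hEm)]
    calc _ ≤ ∫⁻ _ in S' ∩ E, ENNReal.ofReal (Real.exp ε) ∂μ :=
          setLIntegral_mono measurable_const fun w hw =>
            ENNReal.ofReal_le_ofReal (Real.exp_le_exp.2 hw.2)
      _ = ENNReal.ofReal (Real.exp ε) * μ (S' ∩ E) := by simp
      _ ≤ _ := by gcongr; exact Set.inter_subset_left
  have h2 : μ.map (fun w => d + w) Eᶜ ≤ ENNReal.ofReal δ := by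
    rw [Measure.map_apply (by fun_prop) hEm.compl]
    -- the privacy loss exceeds `ε` when a centred Gaussian variable of variance `v Q` exceeds `t`;
    -- `ε ≤ 2 ℓ` makes `t ≥ 3 ε v / 4`, which gives the exponent `t² / (2 v Q) ≥ 9 ℓ / 8 ≥ ℓ`
    set t := ε * v - Q / 2 with ht
    have hQv : Q ≤ v * ε / 2 := by
      have h3 : 4 * Q * ℓ ≤ v * ε * (2 * ℓ) :=
        hv.trans (by rw [sq, ← mul_assoc]; gcongr)
      have h4 : (4 * Q) * ℓ ≤ (v * ε * 2) * ℓ := by linarith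
      have := le_of_mul_le_mul_right h4 hℓ0
      linarith
    have ht0 : 3 / 4 * (ε * v) ≤ t := by rw [ht]; linarith
    have hpos : 0 < ε * v := mul_pos hε hvpos
    calc _ ≤ μ {w | t ≤ ∑ i, d i * w i} := by
          refine measure_mono fun w hw => ?_
          have hw' : ε < r (d + w) := not_le.1 hw
          simp only [hr, Pi.add_apply, mul_add, Finset.sum_add_distrib] at hw'
          have h5 : ∑ i, d i * d i = Q := by rw [hQ]; simp only [sq]
          rw [h5, div_sub_div _ _ hvpos.ne' (by positivity), lt_div_iff₀ (by positivity)] at hw'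
          have h6 : v * (2 * (ε * v)) < v * (2 * (∑ i, d i * w i) + Q) := by nlinarith
          have h7 := lt_of_mul_lt_mul_left h6 hvpos.le
          change t ≤ ∑ i, d i * w i
          rw [ht]; linarith
      _ ≤ ENNReal.ofReal (Real.exp (-t ^ 2 / (2 * (v * Q)))) :=
          pi_gaussianReal_tail d v (by linarith)
      _ ≤ ENNReal.ofReal δ := by
          refine ENNReal.ofReal_le_ofReal ?_
          have h8 : Real.exp (-ℓ) = δ / 2 := by
            rw [hℓ, ← Real.log_inv, Real.exp_log (by positivity), inv_div]
          have h9 : -t ^ 2 / (2 * (v * Q)) ≤ -ℓ := by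
            rw [div_le_iff₀ (by positivity)]
            have h10 : (3 / 4 * (ε * v)) ^ 2 ≤ t ^ 2 := by gcongr
            have h11 : v * (4 * Q * ℓ) ≤ v * (v * ε ^ 2) := by gcongr
            have h12 : 0 < v * Q * ℓ := by positivity
            nlinarith
          linarith [Real.exp_le_exp.2 h9]
  calc μ.map (fun w => d + w) S' ≤ μ.map (fun w => d + w) (S' ∩ E) + μ.map (fun w => d + w) Eᶜ := by
        refine (measure_mono fun w hw => ?_).trans (measure_union_le _ _)
        by_cases h : w ∈ E
        · exact Or.inl ⟨hw, h⟩
        · exact Or.inr h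
    _ ≤ _ := add_le_add h1 h2

end FedWavelet

namespace FedWavelet

/-! ### Pointwise bounds for the wavelets, and privacy of the transcripts -/

lemma sum_width {l₀ L : ℕ} (hL : l₀ + 1 ≤ L) : ∑ l ∈ Finset.Icc l₀ L, width l₀ l = 2 ^ (L + 1) := by
  induction L, hL using Nat.le_induction with
  | base =>
    rw [← Finset.insert_Icc_right_eq_Icc_add_one (by omega)]
    simp [width]
    ring
  | succ L hL ih =>
    rw [← Finset.insert_Icc_right_eq_Icc_add_one (by omega), Finset.sum_insert (by simp), ih, width,
      max_eq_left (by omega)]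
    ring

lemma card_indices {l₀ L : ℕ} (hL : l₀ + 1 ≤ L) : (indices l₀ L).card = 2 ^ (L + 1) := by
  rw [indices, Finset.card_sigma, ← sum_width hL]
  simp

lemma mem_indices {l₀ L : ℕ} (a : indices l₀ L) : l₀ ≤ a.1.1 ∧ a.1.2 < width l₀ a.1.1 := by
  have h := a.2
  simp only [indices, Finset.mem_sigma, Finset.mem_Icc, Finset.mem_range] at h
  exact ⟨h.1.1, h.2⟩

lemma abs_clip_le {τ : ℝ} (hτ : 0 ≤ τ) (x : ℝ) : |clip τ x| ≤ τ :=
  abs_le.2 ⟨le_max_left _ _, max_le (by linarith) (min_le_right _ _)⟩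

namespace WaveletSystem

variable {l₀ : ℕ} (W : WaveletSystem l₀)

lemma supNorm_nonneg : 0 ≤ W.supNorm := by
  refine Real.sSup_nonneg ?_
  rintro _ ⟨l, k, x, -, -, rfl⟩
  positivity

lemma abs_psi_le {l k : ℕ} (hl : l₀ ≤ l) (hk : k < width l₀ l) (x : unitInterval) :
    |W.psi l k x| ≤ W.supNorm * √(width l₀ l) := by
  have h : |W.psi l k x| / (2 : ℝ) ^ (((max l (l₀ + 1) : ℕ) : ℝ) / 2) ≤ W.supNorm :=
    le_csSup W.bddAbove_supNorm ⟨l, k, x, hl, hk, rfl⟩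
  rw [div_le_iff₀ (by positivity)] at h
  refine h.trans_eq ?_
  rw [width, Real.sqrt_eq_rpow]
  push_cast
  rw [← Real.rpow_natCast, ← Real.rpow_mul (by norm_num)]
  push_cast
  congr 2
  ring

lemma psi_sq_le {l k : ℕ} (hl : l₀ ≤ l) (hk : k < width l₀ l) (x : unitInterval) :
    W.psi l k x ^ 2 ≤ W.supNorm ^ 2 * width l₀ l := by
  have h := pow_le_pow_left₀ (abs_nonneg _) (W.abs_psi_le hl hk x) 2
  rwa [sq_abs, mul_pow, Real.sq_sqrt (by positivity)] at h

/-- At each point at most `overlap` functions of one level contribute to a sum over the level. -/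
lemma sum_le_overlap_mul {l : ℕ} (hl : l₀ ≤ l) (x : unitInterval) {F : ℕ → ℝ} {B : ℝ} (hB : 0 ≤ B)
    (h0 : ∀ k, W.psi l k x = 0 → F k = 0) (hF : ∀ k < width l₀ l, F k ≤ B) :
    ∑ k ∈ Finset.range (width l₀ l), F k ≤ W.overlap * B := by
  classical
  have h1 : ∑ k ∈ (Finset.range (width l₀ l)).filter (fun k => W.psi l k x ≠ 0), F k =
      ∑ k ∈ Finset.range (width l₀ l), F k :=
    Finset.sum_filter_of_ne fun k _ hk h => hk (h0 k h)
  rw [← h1]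
  refine (Finset.sum_le_card_nsmul _ _ B fun k hk => hF k ?_).trans ?_
  · exact Finset.mem_range.1 (Finset.mem_filter.1 hk).1
  rw [nsmul_eq_mul]
  refine mul_le_mul_of_nonneg_right ?_ hB
  refine Nat.cast_le.2 (le_csSup W.bddAbove_overlap ⟨l, x, hl, ?_⟩)
  congr

lemma sum_indices_psi_sq_le {L : ℕ} (hL : l₀ + 1 ≤ L) (x : unitInterval) :
    ∑ a : indices l₀ L, W.psi a.1.1 a.1.2 x ^ 2 ≤ W.cPsi ^ 2 * 2 ^ L / 4 := by
  rw [Finset.sum_coe_sort (indices l₀ L) fun a => W.psi a.1 a.2 x ^ 2, indices, Finset.sum_sigma]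
  calc _ ≤ ∑ l ∈ Finset.Icc l₀ L, W.overlap * (W.supNorm ^ 2 * width l₀ l) := by
        refine Finset.sum_le_sum fun l hl => ?_
        have hl' := (Finset.mem_Icc.1 hl).1
        refine W.sum_le_overlap_mul hl' x (by positivity) (fun k hk => ?_) fun k hk =>
          W.psi_sq_le hl' hk x
        simp [hk]
    _ = W.overlap * W.supNorm ^ 2 * ((∑ l ∈ Finset.Icc l₀ L, width l₀ l : ℕ) : ℝ) := by
        push_cast
        rw [Finset.mul_sum]
        simp only [mul_assoc]
    _ = _ := by
        rw [sum_width hL, cPsi, mul_pow, mul_pow, mul_pow, Real.sq_sqrt (by positivity),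
          Real.sq_sqrt (by positivity)]
        push_cast
        ring

/-- The `ℓ₂`-sensitivity of the clipped empirical coefficients. -/
lemma sum_empCoef_sub_sq_le {L : ℕ} (hL : l₀ + 1 ≤ L) {τ : ℝ} (hτ : 0 ≤ τ) {n : ℕ} (hn : 0 < n)
    {z z' : Fin n → Obs} (hz : ∃ i₀, ∀ i, i ≠ i₀ → z i = z' i) :
    ∑ a : indices l₀ L, (W.empCoef L τ z a - W.empCoef L τ z' a) ^ 2 ≤
      τ ^ 2 * 2 ^ L * W.cPsi ^ 2 / n ^ 2 := by
  obtain ⟨i₀, hi₀⟩ := hz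
  have hn' : (0 : ℝ) < n := by exact_mod_cast hn
  have hdiff : ∀ a, W.empCoef L τ z a - W.empCoef L τ z' a =
      (1 / (n : ℝ)) * (clip τ (z i₀).1 * W.psi a.1.1 a.1.2 (z i₀).2 -
        clip τ (z' i₀).1 * W.psi a.1.1 a.1.2 (z' i₀).2) := fun a => by
    unfold empCoef
    rw [← mul_sub, ← Finset.sum_sub_distrib, Finset.sum_eq_single i₀]
    · intro i _ hi
      rw [hi₀ i hi, sub_self]
    · simp
  have hsq : ∀ u v : ℝ, |u| ≤ τ → (u * v) ^ 2 ≤ τ ^ 2 * v ^ 2 := fun u v hu => by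
    rw [mul_pow, ← sq_abs u]
    gcongr
  calc _ ≤ ∑ a : indices l₀ L, (1 / (n : ℝ) ^ 2) * (2 * τ ^ 2 * (W.psi a.1.1 a.1.2 (z i₀).2 ^ 2 +
        W.psi a.1.1 a.1.2 (z' i₀).2 ^ 2)) := by
        refine Finset.sum_le_sum fun a _ => ?_
        rw [hdiff, mul_pow, div_pow, one_pow]
        gcongr
        have h1 := hsq _ (W.psi a.1.1 a.1.2 (z i₀).2) (abs_clip_le hτ (z i₀).1)
        have h2 := hsq _ (W.psi a.1.1 a.1.2 (z' i₀).2) (abs_clip_le hτ (z' i₀).1)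
        nlinarith [sq_nonneg (clip τ (z i₀).1 * W.psi a.1.1 a.1.2 (z i₀).2 +
          clip τ (z' i₀).1 * W.psi a.1.1 a.1.2 (z' i₀).2)]
    _ ≤ (1 / (n : ℝ) ^ 2) * (2 * τ ^ 2 * (W.cPsi ^ 2 * 2 ^ L / 4 + W.cPsi ^ 2 * 2 ^ L / 4)) := by
        rw [← Finset.mul_sum, ← Finset.mul_sum, Finset.sum_add_distrib]
        gcongr
        · exact W.sum_indices_psi_sq_le hL _
        · exact W.sum_indices_psi_sq_le hL _
    _ = _ := by ring

lemma coe_noiseVar (L : ℕ) (τ : ℝ) (n : ℕ) (ε : ℝ) {δ : ℝ} (hδ : 0 < δ) (hδ1 : δ ≤ 1) :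
    (W.noiseVar L τ n ε δ : ℝ) =
      4 * τ ^ 2 * 2 ^ L * W.cPsi ^ 2 * Real.log (2 / δ) / ((n : ℝ) ^ 2 * ε ^ 2) := by
  have : 0 ≤ Real.log (2 / δ) := Real.log_nonneg (by rw [le_div_iff₀ hδ]; linarith)
  rw [noiseVar, Real.coe_toNNReal _ (by positivity)]

/-- The Gaussian transcripts are differentially private. -/
lemma isDP_transcript {L : ℕ} (hL : l₀ + 1 ≤ L) {τ : ℝ} (hτ : 0 ≤ τ) {n : ℕ} (hn : 0 < n)
    {ε δ : ℝ} (hε : 0 < ε) (hδ : 0 < δ) (hδ1 : δ ≤ 1) (hεδ : ε ≤ 2 * Real.log (2 / δ)) :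
    IsDP (W.transcript L τ n ε δ) ε δ := by
  classical
  intro z z' hz S hS
  have hz' : ∃ i₀, ∀ i, i ≠ i₀ → z i = z' i := by
    have hc : (Finset.univ.filter fun i => z i ≠ z' i).card ≤ 1 := by
      convert! hz
    by_cases h : ∃ i₀, z i₀ ≠ z' i₀
    · obtain ⟨i₀, h0⟩ := h
      refine ⟨i₀, fun i hi => ?_⟩
      by_contra hne
      exact hi (Finset.card_le_one.1 hc i (by simpa using hne) i₀ (by simpa using h0))
    · push Not at h
      exact ⟨⟨0, hn⟩, fun i _ => h i⟩
  have hn' : (0 : ℝ) < n := by exact_mod_cast hn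
  have hs := W.sum_empCoef_sub_sq_le hL hτ hn hz'
  have hℓ : 0 ≤ Real.log (2 / δ) := Real.log_nonneg (by rw [le_div_iff₀ hδ]; linarith)
  refine gaussian_mechanism (W.empCoef L τ z) (W.empCoef L τ z') (W.noiseVar L τ n ε δ) hε hδ hδ1
    hεδ ?_ hS
  rw [W.coe_noiseVar L τ n ε hδ hδ1]
  calc _ ≤ 4 * (τ ^ 2 * 2 ^ L * W.cPsi ^ 2 / n ^ 2) * Real.log (2 / δ) := by gcongr
    _ = _ := by field_simp

end WaveletSystem

end FedWavelet

namespace FedWavelet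

namespace WaveletSystem

variable {l₀ : ℕ} (W : WaveletSystem l₀)

/-! ### Orthonormal expansions -/

lemma memLp_psi {l k : ℕ} (hl : l₀ ≤ l) (hk : k < width l₀ l) (p : ℝ≥0∞) :
    MemLp (W.psi l k) p volume :=
  MemLp.of_bound (W.measurable_psi l k).aestronglyMeasurable _
    (.of_forall fun x => W.abs_psi_le hl hk x)

lemma integrable_mul_psi {f : unitInterval → ℝ} (hf : MemLp f 2 volume) {l k : ℕ} (hl : l₀ ≤ l)
    (hk : k < width l₀ l) : Integrable (fun x => f x * W.psi l k x) volume :=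
  hf.integrable_mul (W.memLp_psi hl hk 2)

variable {W} in
lemma IsRegularBasis.integral_psi_sq {A : ℕ} (hW : W.IsRegularBasis A) {l k : ℕ} (hl : l₀ ≤ l)
    (hk : k < width l₀ l) : ∫ x, W.psi l k x ^ 2 = 1 := by
  have := hW.orthonormal l l k k hl hl hk hk
  simp only [and_self, if_true] at this
  simpa only [sq] using this

variable {W} in
/-- Parseval's identity for finite wavelet sums. -/
lemma IsRegularBasis.lintegral_sum_sq {A : ℕ} (hW : W.IsRegularBasis A) {ι : Type*} [Fintype ι]
    (e : ι → ℕ × ℕ) (he : Function.Injective e)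
    (hv : ∀ a, l₀ ≤ (e a).1 ∧ (e a).2 < width l₀ (e a).1) (c : ι → ℝ) :
    ∫⁻ x, ENNReal.ofReal ((∑ a, c a * W.psi (e a).1 (e a).2 x) ^ 2) =
      ENNReal.ofReal (∑ a, c a ^ 2) := by
  classical
  have hint : ∀ a b, Integrable (fun x => c a * W.psi (e a).1 (e a).2 x *
      (c b * W.psi (e b).1 (e b).2 x)) := fun a b =>
    ((W.memLp_psi (hv a).1 (hv a).2 2).const_mul (c a)).integrable_mul
      ((W.memLp_psi (hv b).1 (hv b).2 2).const_mul (c b))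
  have hexp : ∀ x, (∑ a, c a * W.psi (e a).1 (e a).2 x) ^ 2 =
      ∑ a, ∑ b, c a * W.psi (e a).1 (e a).2 x * (c b * W.psi (e b).1 (e b).2 x) := fun x => by
    rw [sq, Finset.sum_mul_sum]
  rw [← ofReal_integral_eq_lintegral_ofReal]
  · congr 1
    simp_rw [hexp]
    rw [integral_finsetSum _ fun a _ => integrable_finsetSum _ fun b _ => hint a b]
    refine Finset.sum_congr rfl fun a _ => ?_
    rw [integral_finsetSum _ fun b _ => hint a b, Finset.sum_eq_single a]
    · have : ∀ x, c a * W.psi (e a).1 (e a).2 x * (c a * W.psi (e a).1 (e a).2 x) =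
          c a ^ 2 * W.psi (e a).1 (e a).2 x ^ 2 := fun x => by ring
      simp_rw [this]
      rw [integral_const_mul, hW.integral_psi_sq (hv a).1 (hv a).2, mul_one]
    · intro b _ hb
      have : ∀ x, c a * W.psi (e a).1 (e a).2 x * (c b * W.psi (e b).1 (e b).2 x) =
          c a * c b * (W.psi (e a).1 (e a).2 x * W.psi (e b).1 (e b).2 x) := fun x => by ring
      simp_rw [this]
      rw [integral_const_mul, hW.orthonormal _ _ _ _ (hv a).1 (hv b).1 (hv a).2 (hv b).2,
        if_neg, mul_zero]
      rintro ⟨h1, h2⟩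
      exact hb (he (Prod.ext h1.symm h2.symm))
    · simp
  · simp_rw [hexp]
    exact integrable_finsetSum _ fun a _ => integrable_finsetSum _ fun b _ => hint a b
  · exact .of_forall fun x => sq_nonneg _

/-- The component of `f` at level `l`. -/
noncomputable def levelPart (f : unitInterval → ℝ) (l : ℕ) (x : unitInterval) : ℝ :=
  ∑ k ∈ Finset.range (width l₀ l), W.coef f l k * W.psi l k x

lemma measurable_levelPart (f : unitInterval → ℝ) (l : ℕ) : Measurable (W.levelPart f l) :=
  Finset.measurable_sum _ fun k _ => (W.measurable_psi l k).const_mul _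

/-- The ratio of the geometric series that dominates `∑_l ‖levelPart f l‖_∞`. -/
noncomputable def ratio : ℝ := √(1 / 2)

lemma ratio_nonneg : 0 ≤ ratio := Real.sqrt_nonneg _

lemma ratio_lt_one : ratio < 1 := by
  rw [ratio, Real.sqrt_lt' one_pos]; norm_num

lemma abs_levelPart_le {f : unitInterval → ℝ} {R : ℝ} {l : ℕ} (hl : l₀ ≤ l) (hR : 0 ≤ R)
    (hf : ∀ k < width l₀ l, |W.coef f l k| ≤ R * (1 / 2) ^ l) (x : unitInterval) :
    |W.levelPart f l x| ≤ W.overlap * W.supNorm * 2 * R * ratio ^ l := by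
  have hsn := W.supNorm_nonneg
  have h1 : |W.levelPart f l x| ≤ ∑ k ∈ Finset.range (width l₀ l), |W.coef f l k * W.psi l k x| :=
    Finset.abs_sum_le_sum_abs _ _
  refine h1.trans ((W.sum_le_overlap_mul (B := R * (1 / 2) ^ l * (W.supNorm * √(width l₀ l))) hl x
    (by positivity) (fun k hk => by simp [hk]) fun k hk => ?_).trans ?_)
  · rw [abs_mul]
    gcongr
    · exact hf k hk
    · exact W.abs_psi_le hl hk x
  · have h2 : √(width l₀ l : ℝ) * (1 / 2) ^ l ≤ 2 * ratio ^ l := by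
      have hw : (width l₀ l : ℝ) ≤ 2 ^ 2 * 2 ^ l := by
        rw [width]
        push_cast
        rw [← pow_add]
        exact pow_le_pow_right₀ (by norm_num) (by omega)
      have hp : ((1 : ℝ) / 2) ^ l = √((1 / 4) ^ l) := by
        rw [show (1 : ℝ) / 4 = (1 / 2) ^ 2 by norm_num, ← pow_mul, mul_comm, pow_mul,
          Real.sqrt_sq (by positivity)]
      have hr : 2 * ratio ^ l = √(2 ^ 2 * (1 / 2) ^ l) := by
        rw [Real.sqrt_mul (by positivity), Real.sqrt_sq (by norm_num), ratio, Real.sqrt_eq_rpow,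
          Real.sqrt_eq_rpow, ← Real.rpow_natCast, ← Real.rpow_natCast, ← Real.rpow_mul (by norm_num),
          ← Real.rpow_mul (by norm_num), mul_comm (l : ℝ)]
      rw [hp, hr, ← Real.sqrt_mul (by positivity)]
      refine Real.sqrt_le_sqrt ?_
      calc _ ≤ (2 ^ 2 * 2 ^ l : ℝ) * (1 / 4) ^ l := by gcongr
        _ = _ := by rw [mul_assoc, ← mul_pow]; norm_num
    calc _ = W.overlap * W.supNorm * R * (√(width l₀ l : ℝ) * (1 / 2) ^ l) := by ring
      _ ≤ W.overlap * W.supNorm * R * (2 * ratio ^ l) := by gcongr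
      _ = _ := by ring

lemma integral_levelPart_mul_psi {A : ℕ} (hW : W.IsRegularBasis A) (f : unitInterval → ℝ)
    {l l' k' : ℕ} (hl : l₀ ≤ l) (hl' : l₀ ≤ l') (hk' : k' < width l₀ l') :
    ∫ x, W.levelPart f l x * W.psi l' k' x = if l = l' then W.coef f l' k' else 0 := by
  have h1 : ∀ x, W.levelPart f l x * W.psi l' k' x =
      ∑ k ∈ Finset.range (width l₀ l), W.coef f l k * (W.psi l k x * W.psi l' k' x) := fun x => by
    rw [levelPart, Finset.sum_mul]
    simp only [mul_assoc]
  simp_rw [h1]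
  rw [integral_finsetSum]
  · simp_rw [integral_const_mul]
    rw [Finset.sum_congr rfl fun k hk => by
      rw [hW.orthonormal l l' k k' hl hl' (Finset.mem_range.1 hk) hk']]
    by_cases h : l = l'
    · subst h
      simp only [true_and, mul_ite, mul_one, mul_zero, if_true]
      rw [Finset.sum_ite_eq' , if_pos (Finset.mem_range.2 hk')]
    · simp [h]
  · intro k hk
    exact ((W.memLp_psi hl (Finset.mem_range.1 hk) 2).integrable_mul
      (W.memLp_psi hl' hk' 2)).const_mul _

/-- If the wavelet coefficients of `f` decay like `2⁻ˡ`, the wavelet series of `f` converges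
pointwise almost everywhere to `f`, and it is dominated by a geometric series. -/
lemma ae_hasSum_levelPart {A : ℕ} (hW : W.IsRegularBasis A) {f : unitInterval → ℝ}
    (hf : MemLp f 2 volume) {R : ℝ} (hR : 0 ≤ R)
    (hc : ∀ l k, l₀ ≤ l → k < width l₀ l → |W.coef f l k| ≤ R * (1 / 2) ^ l) :
    ∀ᵐ x, HasSum (fun i => W.levelPart f (l₀ + i) x) (f x) := by
  set K := W.overlap * W.supNorm * 2 * R with hK
  have hsn := W.supNorm_nonneg
  have hK0 : 0 ≤ K := by positivity
  have hb : ∀ i x, |W.levelPart f (l₀ + i) x| ≤ K * ratio ^ i := fun i x => by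
    refine (W.abs_levelPart_le (by omega) hR (fun k hk => hc _ k (by omega) hk) x).trans ?_
    exact mul_le_mul_of_nonneg_left
      (pow_le_pow_of_le_one ratio_nonneg ratio_lt_one.le (by omega)) hK0
  have hgs : Summable fun i => K * ratio ^ i :=
    (summable_geometric_of_lt_one ratio_nonneg ratio_lt_one).mul_left K
  have hs : ∀ x, Summable fun i => W.levelPart f (l₀ + i) x := fun x =>
    Summable.of_norm_bounded hgs fun i => hb i x
  set G : unitInterval → ℝ := fun x => ∑' i, W.levelPart f (l₀ + i) x with hG
  have hGm : Measurable G := Measurable.tsum fun i => W.measurable_levelPart f _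
  have hGb : ∀ x, ‖G x‖ ≤ ∑' i, K * ratio ^ i := fun x =>
    tsum_of_norm_bounded hgs.hasSum fun i => hb i x
  have hGL : MemLp G 2 volume :=
    MemLp.of_bound hGm.aestronglyMeasurable _ (.of_forall hGb)
  -- the sum of the series has the coefficients of `f`, so that completeness identifies it with `f`
  have hGc : ∀ l k, l₀ ≤ l → k < width l₀ l → W.coef G l k = W.coef f l k := by
    intro l k hl hk
    have hF : ∀ i, Integrable (fun x => W.levelPart f (l₀ + i) x * W.psi l k x) := fun i =>
      W.integrable_mul_psi (MemLp.of_bound (W.measurable_levelPart f _).aestronglyMeasurable _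
        (.of_forall (hb i))) hl hk
    set B := W.supNorm * √(width l₀ l : ℝ)
    have hB : 0 ≤ B := by positivity
    have hpt : ∀ i x, ‖W.levelPart f (l₀ + i) x * W.psi l k x‖ ≤ K * ratio ^ i * B :=
      fun i x => by
        rw [norm_mul]
        exact mul_le_mul (hb i x) (W.abs_psi_le hl hk x) (abs_nonneg _)
          ((abs_nonneg _).trans (hb i x))
    have hsum : Summable fun i => ∫ x, ‖W.levelPart f (l₀ + i) x * W.psi l k x‖ := by
      refine Summable.of_nonneg_of_le (fun i => integral_nonneg fun x => norm_nonneg _)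
        (fun i => ?_) (hgs.mul_right B)
      calc _ ≤ ∫ _ : unitInterval, K * ratio ^ i * B :=
            integral_mono (hF i).norm (integrable_const _) (hpt i)
        _ = _ := by simp
    have hmain := hasSum_integral_of_summable_integral_norm hF hsum
    have h2 : (∫ x, ∑' i, W.levelPart f (l₀ + i) x * W.psi l k x) = W.coef G l k := by
      rw [coef]
      refine integral_congr_ae (.of_forall fun x => ?_)
      simp only [hG]
      rw [tsum_mul_right]
    rw [h2] at hmain
    refine hmain.unique ?_
    have h3 := hasSum_single (f := fun i => ∫ x, W.levelPart f (l₀ + i) x * W.psi l k x) (l - l₀)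
      fun i hi => by
        rw [W.integral_levelPart_mul_psi hW f (by omega) hl hk, if_neg (by omega)]
    rwa [W.integral_levelPart_mul_psi hW f (by omega) hl hk, if_pos (by omega)] at h3
  have hz := hW.complete (f - G) (hf.sub hGL) fun l k hl hk => by
    have h3 : W.coef (f - G) l k = W.coef f l k - W.coef G l k := by
      simp only [coef]
      rw [← integral_sub (W.integrable_mul_psi hf hl hk) (W.integrable_mul_psi hGL hl hk)]
      simp only [Pi.sub_apply, sub_mul]
    rw [h3, hGc l k hl hk, sub_self]
  filter_upwards [hz] with x hx
  have h4 : f x = G x := sub_eq_zero.1 hx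
  rw [h4]
  exact (hs x).hasSum

lemma ae_abs_le_of_coef_le {A : ℕ} (hW : W.IsRegularBasis A) {f : unitInterval → ℝ}
    (hf : MemLp f 2 volume) {R : ℝ} (hR : 0 ≤ R)
    (hc : ∀ l k, l₀ ≤ l → k < width l₀ l → |W.coef f l k| ≤ R * (1 / 2) ^ l) :
    ∀ᵐ x, |f x| ≤ W.overlap * W.supNorm * 2 * R * (1 - ratio)⁻¹ := by
  have hsn := W.supNorm_nonneg
  filter_upwards [W.ae_hasSum_levelPart hW hf hR hc] with x hx
  rw [← hx.tsum_eq]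
  refine tsum_of_norm_bounded (E := ℝ)
    ((hasSum_geometric_of_lt_one ratio_nonneg ratio_lt_one).mul_left _) fun i => ?_
  refine (W.abs_levelPart_le (by omega) hR (fun k hk => hc _ k (by omega) hk) x).trans ?_
  exact mul_le_mul_of_nonneg_left
    (pow_le_pow_of_le_one ratio_nonneg ratio_lt_one.le (by omega)) (by positivity)

/-- The projection of `f` on the levels `l ≤ L`. -/
noncomputable def proj (f : unitInterval → ℝ) (L : ℕ) (x : unitInterval) : ℝ :=
  ∑ l ∈ Finset.Ico l₀ (L + 1), W.levelPart f l x

lemma measurable_proj (f : unitInterval → ℝ) (L : ℕ) : Measurable (W.proj f L) :=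
  Finset.measurable_sum _ fun l _ => W.measurable_levelPart f l

lemma proj_eq_sum_indices (f : unitInterval → ℝ) (L : ℕ) (x : unitInterval) :
    W.proj f L x = ∑ a : indices l₀ L, W.coef f a.1.1 a.1.2 * W.psi a.1.1 a.1.2 x := by
  rw [Finset.sum_coe_sort (indices l₀ L) fun a => W.coef f a.1 a.2 * W.psi a.1 a.2 x, indices,
    Finset.sum_sigma]
  rfl

lemma lintegral_proj_sub_proj_sq {A : ℕ} (hW : W.IsRegularBasis A) (f : unitInterval → ℝ)
    {L M : ℕ} (hL : l₀ ≤ L) (hLM : L ≤ M) :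
    ∫⁻ x, ENNReal.ofReal ((W.proj f M x - W.proj f L x) ^ 2) =
      ENNReal.ofReal (∑ l ∈ Finset.Ico (L + 1) (M + 1),
        ∑ k ∈ Finset.range (width l₀ l), W.coef f l k ^ 2) := by
  set T := (Finset.Ico (L + 1) (M + 1)).sigma fun l => Finset.range (width l₀ l) with hT
  have h1 : ∀ x, W.proj f M x - W.proj f L x =
      ∑ a : T, W.coef f a.1.1 a.1.2 * W.psi a.1.1 a.1.2 x := fun x => by
    rw [Finset.sum_coe_sort T fun a => W.coef f a.1 a.2 * W.psi a.1 a.2 x, hT, Finset.sum_sigma,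
      proj, proj, ← Finset.sum_Ico_consecutive _ (show l₀ ≤ L + 1 by omega)
      (show L + 1 ≤ M + 1 by omega), add_sub_cancel_left]
    rfl
  simp_rw [h1]
  rw [hW.lintegral_sum_sq (fun a : T => (a.1.1, a.1.2)) ?_ ?_ fun a => W.coef f a.1.1 a.1.2]
  · rw [Finset.sum_coe_sort T fun a => W.coef f a.1 a.2 ^ 2, hT, Finset.sum_sigma]
  · rintro ⟨⟨l, k⟩, _⟩ ⟨⟨l', k'⟩, _⟩ h
    simpa using h
  · rintro ⟨⟨l, k⟩, h⟩
    simp only [hT, Finset.mem_sigma, Finset.mem_Ico, Finset.mem_range] at h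
    exact ⟨by simp only; omega, h.2⟩

/-- The approximation error of the projections, in `L₂`. -/
lemma lintegral_sub_proj_sq_le {A : ℕ} (hW : W.IsRegularBasis A) {f : unitInterval → ℝ}
    (hf : MemLp f 2 volume) {R α : ℝ} (hR : 0 ≤ R) (hα : 1 / 2 ≤ α)
    (hc : ∀ l k, l₀ ≤ l → k < width l₀ l → |W.coef f l k| ≤ R * (1 / 2) ^ l)
    (hs : ∀ l, l₀ < l → ∑ k ∈ Finset.range (width l₀ l), W.coef f l k ^ 2 ≤
      R ^ 2 * (2 : ℝ) ^ (-2 * (l : ℝ) * α)) {L : ℕ} (hL : l₀ ≤ L) :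
    ∫⁻ x, ENNReal.ofReal ((f x - W.proj f L x) ^ 2) ≤
      ENNReal.ofReal (R ^ 2 * (2 : ℝ) ^ (-2 * (L : ℝ) * α)) := by
  set B := R ^ 2 * (2 : ℝ) ^ (-2 * (L : ℝ) * α)
  have hB : 0 ≤ B := by positivity
  have htail : ∀ M, L ≤ M → ∑ l ∈ Finset.Ico (L + 1) (M + 1),
      ∑ k ∈ Finset.range (width l₀ l), W.coef f l k ^ 2 ≤ B := by
    intro M hM
    calc _ ≤ ∑ l ∈ Finset.Ico (L + 1) (M + 1), R ^ 2 * (2 : ℝ) ^ (-2 * (l : ℝ) * α) :=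
          Finset.sum_le_sum fun l hl => hs l (by have := (Finset.mem_Ico.1 hl).1; omega)
      _ = ∑ i ∈ Finset.range (M - L), R ^ 2 * (2 : ℝ) ^ (-2 * ((L + 1 + i : ℕ) : ℝ) * α) := by
          rw [Finset.sum_Ico_eq_sum_range]
          congr 2
          omega
      _ ≤ ∑ i ∈ Finset.range (M - L), B * (1 / 2) * (1 / 2) ^ i := by
          refine Finset.sum_le_sum fun i _ => ?_
          have : (2 : ℝ) ^ (-2 * ((L + 1 + i : ℕ) : ℝ) * α) ≤
              (2 : ℝ) ^ (-2 * (L : ℝ) * α) * ((1 / 2) * (1 / 2) ^ i) := by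
            rw [← pow_succ', one_div, inv_pow, ← Real.rpow_natCast, ← Real.rpow_neg (by norm_num),
              ← Real.rpow_add (by norm_num)]
            refine Real.rpow_le_rpow_of_exponent_le (by norm_num) ?_
            push_cast
            nlinarith [mul_nonneg (Nat.cast_nonneg (α := ℝ) i) (sub_nonneg.2 hα)]
          calc _ ≤ R ^ 2 * ((2 : ℝ) ^ (-2 * (L : ℝ) * α) * ((1 / 2) * (1 / 2) ^ i)) := by gcongr
            _ = _ := by ring
      _ ≤ B := by
          rw [← Finset.mul_sum]
          have h1 : ∑ i ∈ Finset.range (M - L), ((1 : ℝ) / 2) ^ i ≤ 2 := by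
            have := summable_geometric_two.sum_le_tsum (Finset.range (M - L)) fun i _ => by positivity
            rwa [tsum_geometric_two] at this
          calc _ ≤ B * (1 / 2) * 2 := by gcongr
            _ = B := by ring
  have hlim : ∀ᵐ x, Filter.Tendsto (fun M => W.proj f M x) Filter.atTop (nhds (f x)) := by
    filter_upwards [W.ae_hasSum_levelPart hW hf hR hc] with x hx
    have h1 := hx.tendsto_sum_nat.comp
      ((Filter.tendsto_sub_atTop_nat l₀).comp (Filter.tendsto_add_atTop_nat 1))
    refine h1.congr fun M => ?_
    simp only [Function.comp, proj]
    rw [Finset.sum_Ico_eq_sum_range]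
  calc ∫⁻ x, ENNReal.ofReal ((f x - W.proj f L x) ^ 2)
      = ∫⁻ x, Filter.liminf (fun M => ENNReal.ofReal ((W.proj f M x - W.proj f L x) ^ 2))
          Filter.atTop := by
        refine lintegral_congr_ae ?_
        filter_upwards [hlim] with x hx
        refine (Filter.Tendsto.liminf_eq ?_).symm
        exact (ENNReal.continuous_ofReal.tendsto _).comp ((hx.sub_const _).pow 2)
    _ ≤ Filter.liminf (fun M => ∫⁻ x, ENNReal.ofReal ((W.proj f M x - W.proj f L x) ^ 2))
          Filter.atTop :=
        lintegral_liminf_le fun M =>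
          (((W.measurable_proj f M).sub (W.measurable_proj f L)).pow_const 2).ennreal_ofReal
    _ ≤ ENNReal.ofReal B := by
        refine Filter.liminf_le_of_le (by isBoundedDefault) fun b hb => ?_
        obtain ⟨M, hM1, hM2⟩ := (hb.and (Filter.eventually_ge_atTop L)).exists
        rw [W.lintegral_proj_sub_proj_sq hW f hL hM2] at hM1
        exact hM1.trans (ENNReal.ofReal_le_ofReal (htail M hM2))

/-! ### Wavelet coefficients of functions in a Besov ball -/

lemma besovTerm_le_besovNorm (α : ℝ) (p : ℝ≥0∞) {q : ℝ≥0∞} (hq : 1 ≤ q) (f : unitInterval → ℝ)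
    {l : ℕ} (hl : l₀ ≤ l) : W.besovTerm α p f l ≤ W.besovNorm α p q f := by
  obtain ⟨i, rfl⟩ := Nat.exists_eq_add_of_le hl
  unfold besovNorm
  split_ifs with h
  · exact le_iSup (fun i => W.besovTerm α p f (l₀ + i)) i
  · have hq0 : 0 < q.toReal := ENNReal.toReal_pos (zero_lt_one.trans_le hq).ne' h
    calc _ = (W.besovTerm α p f (l₀ + i) ^ q.toReal) ^ (1 / q.toReal) := by
          rw [← ENNReal.rpow_mul, mul_one_div_cancel hq0.ne', ENNReal.rpow_one]
      _ ≤ _ := by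
          refine ENNReal.rpow_le_rpow ?_ (by positivity)
          exact ENNReal.le_tsum (f := fun i => W.besovTerm α p f (l₀ + i) ^ q.toReal) i

lemma levelNorm_le {α R : ℝ} {p q : ℝ≥0∞} (hq : 1 ≤ q) {f : unitInterval → ℝ}
    (hf : f ∈ W.besovBall α p q R) {l : ℕ} (hl : l₀ ≤ l) :
    W.levelNorm p f l ≤
      ENNReal.ofReal (R * (2 : ℝ) ^ (-((l : ℝ) * (α + 1 / 2 - (p⁻¹).toReal)))) := by
  have h := (W.besovTerm_le_besovNorm α p hq f hl).trans hf.2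
  unfold besovTerm at h
  set s := (l : ℝ) * (α + 1 / 2 - (p⁻¹).toReal)
  have h2 : (0 : ℝ) < 2 ^ s := by positivity
  rw [mul_comm, ← ENNReal.le_div_iff_mul_le (Or.inl (by simpa using h2))
    (Or.inl ENNReal.ofReal_ne_top), ← ENNReal.ofReal_div_of_pos h2] at h
  rwa [Real.rpow_neg (by norm_num), ← div_eq_mul_inv]

lemma abs_coef_le_levelNorm {p : ℝ≥0∞} (hp : 2 ≤ p) (f : unitInterval → ℝ) {l k : ℕ}
    (hk : k < width l₀ l) : ENNReal.ofReal |W.coef f l k| ≤ W.levelNorm p f l := by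
  unfold levelNorm
  have hk' := Finset.mem_range.2 hk
  split_ifs with h
  · exact le_iSup₂ (f := fun k (_ : k ∈ Finset.range (width l₀ l)) =>
      ENNReal.ofReal |W.coef f l k|) k hk'
  · have hp0 : 0 < p.toReal := ENNReal.toReal_pos (two_pos.trans_le hp).ne' h
    calc _ = (ENNReal.ofReal |W.coef f l k| ^ p.toReal) ^ (1 / p.toReal) := by
          rw [← ENNReal.rpow_mul, mul_one_div_cancel hp0.ne', ENNReal.rpow_one]
      _ ≤ _ := by
          refine ENNReal.rpow_le_rpow ?_ (by positivity)
          exact Finset.single_le_sum (f := fun k => ENNReal.ofReal |W.coef f l k| ^ p.toReal)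
            (fun _ _ => zero_le) hk'

lemma abs_coef_le {α R : ℝ} (hR : 0 < R) {p q : ℝ≥0∞} (hp : 2 ≤ p) (hq : 1 ≤ q)
    {f : unitInterval → ℝ} (hf : f ∈ W.besovBall α p q R) {l k : ℕ} (hl : l₀ ≤ l)
    (hk : k < width l₀ l) :
    |W.coef f l k| ≤ R * (2 : ℝ) ^ (-((l : ℝ) * (α + 1 / 2 - (p⁻¹).toReal))) :=
  (ENNReal.ofReal_le_ofReal_iff (by positivity)).1
    ((W.abs_coef_le_levelNorm hp f hk).trans (W.levelNorm_le hq hf hl))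

lemma abs_coef_le_half_pow {α R : ℝ} (hR : 0 < R) {p q : ℝ≥0∞} (hp : 2 ≤ p) (hq : 1 ≤ q)
    (hα : 1 / 2 < α - (p⁻¹).toReal) {f : unitInterval → ℝ} (hf : f ∈ W.besovBall α p q R) (l k : ℕ)
    (hl : l₀ ≤ l) (hk : k < width l₀ l) : |W.coef f l k| ≤ R * (1 / 2) ^ l := by
  refine (W.abs_coef_le hR hp hq hf hl hk).trans ?_
  gcongr
  rw [one_div, inv_pow, ← Real.rpow_natCast, ← Real.rpow_neg (by norm_num)]
  refine Real.rpow_le_rpow_of_exponent_le (by norm_num) ?_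
  nlinarith [Nat.cast_nonneg (α := ℝ) l]

/-- The embedding of the `ℓ_p` Besov ball in the `ℓ_2` Sobolev ball, level by level. -/
lemma sum_coef_sq_le {α R : ℝ} (hR : 0 < R) {p q : ℝ≥0∞} (hp : 2 ≤ p) (hq : 1 ≤ q)
    {f : unitInterval → ℝ} (hf : f ∈ W.besovBall α p q R) (l : ℕ) (hl : l₀ < l) :
    ∑ k ∈ Finset.range (width l₀ l), W.coef f l k ^ 2 ≤ R ^ 2 * (2 : ℝ) ^ (-2 * (l : ℝ) * α) := by
  have hw : (width l₀ l : ℝ) = (2 : ℝ) ^ (l : ℝ) := by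
    rw [width, max_eq_left (by omega), Real.rpow_natCast]
    push_cast
    rfl
  by_cases hpt : p = ∞
  · calc _ ≤ ∑ k ∈ Finset.range (width l₀ l),
          (R * (2 : ℝ) ^ (-((l : ℝ) * (α + 1 / 2)))) ^ 2 := by
          refine Finset.sum_le_sum fun k hk => ?_
          have h := W.abs_coef_le hR hp hq hf hl.le (Finset.mem_range.1 hk)
          rw [← sq_abs]
          simp only [hpt, ENNReal.inv_top, ENNReal.toReal_zero, sub_zero] at h
          gcongr
      _ = R ^ 2 * ((2 : ℝ) ^ (l : ℝ) * ((2 : ℝ) ^ (-((l : ℝ) * (α + 1 / 2)))) ^ 2) := by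
          rw [Finset.sum_const, Finset.card_range, nsmul_eq_mul, hw]
          ring
      _ = _ := by
          rw [← Real.rpow_natCast ((2 : ℝ) ^ (-((l : ℝ) * (α + 1 / 2)))) 2,
            ← Real.rpow_mul (by norm_num), ← Real.rpow_add (by norm_num)]
          congr 2
          push_cast
          ring
  · set P := p.toReal with hP
    have hP2 : 2 ≤ P := by
      have := ENNReal.toReal_mono hpt hp
      simpa using this
    set b := R * (2 : ℝ) ^ (-((l : ℝ) * (α + 1 / 2 - (p⁻¹).toReal))) with hb
    have hb0 : 0 < b := by positivity
    have h1 := W.levelNorm_le hq hf hl.le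
    unfold levelNorm at h1
    rw [if_neg hpt, ← hP] at h1
    have h2 : ∑ k ∈ Finset.range (width l₀ l), |W.coef f l k| ^ P ≤ b ^ P := by
      have h3 := ENNReal.rpow_le_rpow h1 (show 0 ≤ P by linarith)
      rw [← ENNReal.rpow_mul, one_div_mul_cancel (by linarith), ENNReal.rpow_one,
        ENNReal.ofReal_rpow_of_pos hb0] at h3
      simp_rw [ENNReal.ofReal_rpow_of_nonneg (abs_nonneg _) (show 0 ≤ P by linarith)] at h3
      rw [← ENNReal.ofReal_sum_of_nonneg fun _ _ => by positivity] at h3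
      exact (ENNReal.ofReal_le_ofReal_iff (by positivity)).1 h3
    -- the power mean inequality with exponent `P / 2 ≥ 1`
    have h4 := Real.rpow_sum_le_const_mul_sum_rpow (Finset.range (width l₀ l))
      (fun k => W.coef f l k ^ 2) (p := P / 2) (by linarith)
    simp only [abs_sq, Finset.card_range] at h4
    have h5 : ∀ k, (W.coef f l k ^ 2) ^ (P / 2) = |W.coef f l k| ^ P := fun k => by
      rw [← sq_abs, ← Real.rpow_natCast _ 2, ← Real.rpow_mul (abs_nonneg _)]
      congr 1
      push_cast
      ring
    simp_rw [h5] at h4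
    have h6 : (∑ k ∈ Finset.range (width l₀ l), W.coef f l k ^ 2) ^ (P / 2) ≤
        (R ^ 2 * (2 : ℝ) ^ (-2 * (l : ℝ) * α)) ^ (P / 2) := by
      refine (h4.trans (mul_le_mul_of_nonneg_left h2 (by positivity))).trans_eq ?_
      rw [hw, hb, Real.mul_rpow hR.le (by positivity), Real.mul_rpow (by positivity) (by positivity),
        ← Real.rpow_natCast R 2, ← Real.rpow_mul hR.le, ← Real.rpow_mul (by norm_num),
        ← Real.rpow_mul (by norm_num), ← Real.rpow_mul (by norm_num), mul_left_comm,
        ← Real.rpow_add (by norm_num), ENNReal.toReal_inv, ← hP]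
      congr 2
      · push_cast; ring
      · field_simp
        ring
    exact (Real.rpow_le_rpow_iff (Finset.sum_nonneg fun _ _ => sq_nonneg _) (by positivity)
      (by linarith)).1 h6

end WaveletSystem

end FedWavelet

namespace FedWavelet

/-! ### Mean and variance of the transcripts -/

/-- The variance of a sum of independent variables, as a lower integral over a product space. -/
lemma lintegral_sub_mean_sq_pi {ι : Type*} [Fintype ι] {Ω : ι → Type*}
    [∀ i, MeasurableSpace (Ω i)] {μ : ∀ i, Measure (Ω i)} [∀ i, IsProbabilityMeasure (μ i)]
    {X : ∀ i, Ω i → ℝ} (hX : ∀ i, MemLp (X i) 2 (μ i)) :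
    ∫⁻ ω, ENNReal.ofReal ((∑ i, X i (ω i) - ∑ i, ∫ x, X i x ∂μ i) ^ 2) ∂Measure.pi μ =
      ENNReal.ofReal (∑ i, Var[X i; μ i]) := by
  have hXi : ∀ i, MemLp (fun ω : ∀ i, Ω i => X i (ω i)) 2 (Measure.pi μ) := fun i =>
    (hX i).comp_measurePreserving (measurePreserving_eval _ i)
  have hmean : ∫ ω, (∑ i, fun ω : ∀ i, Ω i => X i (ω i)) ω ∂Measure.pi μ =
      ∑ i, ∫ x, X i x ∂μ i := by
    simp only [Finset.sum_apply]
    rw [integral_finsetSum _ fun i _ => (hXi i).integrable one_le_two]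
    refine Finset.sum_congr rfl fun i _ => ?_
    have hmp := measurePreserving_eval μ i
    conv_rhs => rw [← hmp.map_eq]
    rw [integral_map hmp.measurable.aemeasurable (by rw [hmp.map_eq]; exact (hX i).1)]
  rw [← variance_sum_pi hX, ofReal_variance (memLp_finsetSum' _ fun i _ => hXi i),
    evariance_eq_lintegral_ofReal, hmean]
  simp only [Finset.sum_apply]

lemma isProbabilityMeasure_obsLaw {f : unitInterval → ℝ} (hf : AEMeasurable f volume) :
    IsProbabilityMeasure (obsLaw f) :=
  Measure.isProbabilityMeasure_map ((hf.comp_fst.add measurable_snd.aemeasurable).prodMk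
    measurable_fst.aemeasurable)

lemma integral_obsLaw {f : unitInterval → ℝ} (hf : AEMeasurable f volume) {g : Obs → ℝ}
    (hg : Measurable g) :
    ∫ o, g o ∂obsLaw f =
      ∫ w, g (f w.1 + w.2, w.1) ∂((volume : Measure unitInterval).prod (gaussianReal 0 1)) :=
  integral_map ((hf.comp_fst.add measurable_snd.aemeasurable).prodMk
    measurable_fst.aemeasurable) hg.aestronglyMeasurable

/-- The clipping error of a noisy value `y + s` with `|y| ≤ c`, at a threshold `τ ≥ c + 1`, is
dominated by two exponentials, whose Gaussian means are `exp (-(τ - c)² / 2)`. -/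
lemma abs_clip_sub_le {c t y s : ℝ} (hc : 0 ≤ c) (ht : 1 ≤ t) (hy : |y| ≤ c) :
    |clip (c + t) (y + s) - (y + s)| ≤
      Real.exp (-t ^ 2) * (Real.exp (t * s) + Real.exp (-t * s)) := by
  -- as `t ≥ 1` and `u ≥ t`, the excess `u - t` is at most `t (u - t)`, hence at most its exponential
  have key : ∀ u : ℝ, t ≤ u → u - t ≤ Real.exp (-t ^ 2) * Real.exp (t * u) := fun u hu => by
    rw [← Real.exp_add]
    have h1 := Real.add_one_le_exp (-t ^ 2 + t * u)
    nlinarith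
  obtain ⟨hy1, hy2⟩ := abs_le.1 hy
  have e0 := Real.exp_pos (-t ^ 2)
  have e1 := mul_pos e0 (Real.exp_pos (t * s))
  have e2 := mul_pos e0 (Real.exp_pos (-t * s))
  rw [mul_add]
  unfold clip
  rcases le_total (y + s) (c + t) with h | h
  · rw [min_eq_left h]
    rcases le_total (-(c + t)) (y + s) with h' | h'
    · rw [max_eq_right h', sub_self, abs_zero]
      positivity
    · rw [max_eq_left h', abs_of_nonneg (by linarith)]
      have := key (-s) (by linarith)
      rw [show t * -s = -t * s by ring] at this
      linarith
  · rw [min_eq_right h, max_eq_right (by linarith), abs_of_nonpos (by linarith)]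
    have := key s (by linarith)
    linarith

namespace WaveletSystem

variable {l₀ : ℕ} (W : WaveletSystem l₀)

/-- The clipped product `[Y]_τ ψ_{lk}(X)` of a single observation. -/
noncomputable def clippedProd (τ : ℝ) (l k : ℕ) (o : Obs) : ℝ := clip τ o.1 * W.psi l k o.2

lemma measurable_clippedProd (τ : ℝ) (l k : ℕ) : Measurable (W.clippedProd τ l k) :=
  ((measurable_clip τ).comp measurable_fst).mul ((W.measurable_psi l k).comp measurable_snd)

lemma memLp_clippedProd {τ : ℝ} (hτ : 0 ≤ τ) {l k : ℕ} (hl : l₀ ≤ l) (hk : k < width l₀ l)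
    (μ : Measure Obs) [IsFiniteMeasure μ] : MemLp (W.clippedProd τ l k) 2 μ :=
  MemLp.of_bound (W.measurable_clippedProd τ l k).aestronglyMeasurable
    (τ * (W.supNorm * √(width l₀ l))) (.of_forall fun o => by
      rw [clippedProd, norm_mul]
      exact mul_le_mul (abs_clip_le hτ _) (W.abs_psi_le hl hk _) (abs_nonneg _) hτ)

variable {W} in
lemma variance_clippedProd_le {A : ℕ} (hW : W.IsRegularBasis A) {f : unitInterval → ℝ}
    (hf : AEMeasurable f volume) {τ : ℝ} (hτ : 0 ≤ τ) {l k : ℕ} (hl : l₀ ≤ l)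
    (hk : k < width l₀ l) : Var[W.clippedProd τ l k; obsLaw f] ≤ τ ^ 2 := by
  have := isProbabilityMeasure_obsLaw hf
  refine (variance_le_expectation_sq (W.measurable_clippedProd τ l k).aestronglyMeasurable).trans ?_
  have hb : ∀ o, (W.clippedProd τ l k ^ 2) o ≤ τ ^ 2 * W.psi l k o.2 ^ 2 := fun o => by
    simp only [Pi.pow_apply, clippedProd, mul_pow]
    have := abs_clip_le hτ o.1
    rw [← sq_abs (clip τ o.1)]
    gcongr
  have hm : Measurable fun o : Obs => W.psi l k o.2 ^ 2 :=
    ((W.measurable_psi l k).comp measurable_snd).pow_const 2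
  calc ∫ o, (W.clippedProd τ l k ^ 2) o ∂obsLaw f
      ≤ ∫ o, τ ^ 2 * W.psi l k o.2 ^ 2 ∂obsLaw f := by
        refine integral_mono (W.memLp_clippedProd hτ hl hk _).integrable_sq ?_ hb
        refine Integrable.const_mul ?_ _
        refine Integrable.of_bound hm.aestronglyMeasurable (W.supNorm ^ 2 * width l₀ l)
          (.of_forall fun o => ?_)
        rw [Real.norm_of_nonneg (sq_nonneg _)]
        exact W.psi_sq_le hl hk _
    _ = τ ^ 2 := by
        rw [integral_const_mul, integral_obsLaw hf hm]
        have h := integral_prod_mul (μ := (volume : Measure unitInterval)) (ν := gaussianReal 0 1)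
          (fun x => W.psi l k x ^ 2) (fun _ => (1 : ℝ))
        simp only [mul_one, integral_const, probReal_univ, smul_eq_mul] at h
        rw [h, hW.integral_psi_sq hl hk, mul_one]

variable {W} in
/-- The bias caused by clipping. -/
lemma abs_integral_clippedProd_sub_coef_le {A : ℕ} (hW : W.IsRegularBasis A)
    {f : unitInterval → ℝ} (hf : MemLp f 2 volume) {c t : ℝ} (hc : 0 ≤ c) (ht : 1 ≤ t)
    (hfc : ∀ᵐ x, |f x| ≤ c) {l k : ℕ} (hl : l₀ ≤ l) (hk : k < width l₀ l) :
    |∫ o, W.clippedProd (c + t) l k o ∂obsLaw f - W.coef f l k| ≤ 2 * Real.exp (-t ^ 2 / 2) := by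
  set ν := (volume : Measure unitInterval).prod (gaussianReal 0 1) with hν
  have hfm : AEMeasurable f volume := hf.1.aemeasurable
  have := isProbabilityMeasure_obsLaw hfm
  have hψ1 := (W.memLp_psi hl hk 1).integrable le_rfl
  have hid : Integrable (fun s : ℝ => s) (gaussianReal 0 1) :=
    (memLp_id_gaussianReal' 1 (by simp)).integrable le_rfl
  -- the noise is centred, so that the coefficient is the mean of the unclipped product
  have h1 : Integrable (fun w : unitInterval × ℝ => f w.1 * W.psi l k w.1) ν :=
    (W.integrable_mul_psi hf hl hk).comp_fst _
  have h2 : Integrable (fun w : unitInterval × ℝ => W.psi l k w.1 * w.2) ν := hψ1.mul_prod hid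
  have hcoef : W.coef f l k = ∫ w, (f w.1 + w.2) * W.psi l k w.1 ∂ν := by
    have h3 : ∀ w : unitInterval × ℝ, (f w.1 + w.2) * W.psi l k w.1 =
        f w.1 * W.psi l k w.1 + W.psi l k w.1 * w.2 := fun w => by ring
    simp_rw [h3]
    rw [integral_add h1 h2, hν, integral_prod_mul (fun x => W.psi l k x) (fun s : ℝ => s),
      integral_id_gaussianReal, mul_zero, add_zero, coef]
    have h := integral_prod_mul (μ := (volume : Measure unitInterval)) (ν := gaussianReal 0 1)
      (fun x => f x * W.psi l k x) (fun _ => (1 : ℝ))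
    simp only [mul_one, integral_const, probReal_univ, smul_eq_mul] at h
    exact h.symm
  have h3 : Integrable (fun w : unitInterval × ℝ => (f w.1 + w.2) * W.psi l k w.1) ν :=
    (h1.add h2).congr (.of_forall fun w => by simp only [Pi.add_apply]; ring)
  have h4 : Integrable (fun w : unitInterval × ℝ => W.clippedProd (c + t) l k (f w.1 + w.2, w.1)) ν := by
    have hi := (W.memLp_clippedProd (by linarith : 0 ≤ c + t) hl hk (obsLaw f)).integrable one_le_two
    exact hi.comp_aemeasurable ((hfm.comp_fst.add measurable_snd.aemeasurable).prodMk
      measurable_fst.aemeasurable)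
  rw [integral_obsLaw hfm (W.measurable_clippedProd _ _ _), hcoef, ← integral_sub h4 h3]
  set e : ℝ → ℝ := fun s => Real.exp (-t ^ 2) * (Real.exp (t * s) + Real.exp (-t * s)) with he
  have hei : Integrable e (gaussianReal 0 1) :=
    ((integrable_exp_mul_gaussianReal t).add (integrable_exp_mul_gaussianReal (-t))).const_mul _
  have hex : ∀ r : ℝ, ∫ s, Real.exp (r * s) ∂gaussianReal 0 1 = Real.exp (r ^ 2 / 2) := fun r => by
    have := congrFun (mgf_fun_id_gaussianReal (μ := 0) (v := 1)) r
    simpa [mgf] using this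
  have hee : ∫ s, e s ∂gaussianReal 0 1 = 2 * Real.exp (-t ^ 2 / 2) := by
    rw [he, integral_const_mul, integral_add (integrable_exp_mul_gaussianReal t)
      (integrable_exp_mul_gaussianReal (-t)), hex, hex, neg_sq, ← two_mul, mul_left_comm,
      ← Real.exp_add]
    congr 2
    ring
  -- `|ψ| ≤ (1 + ψ²) / 2`, and `ψ` is normalised in `L₂`
  have hψ : ∫ x, |W.psi l k x| ≤ 1 := by
    have hsq := (W.memLp_psi hl hk 2).integrable_sq
    calc ∫ x, |W.psi l k x| ≤ ∫ x, (1 / 2 + 1 / 2 * W.psi l k x ^ 2) := by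
          refine integral_mono hψ1.abs ((integrable_const _).add (hsq.const_mul _)) fun x => ?_
          simp only
          nlinarith [sq_nonneg (|W.psi l k x| - 1), sq_abs (W.psi l k x)]
      _ = 1 := by
          rw [integral_add (integrable_const _) (hsq.const_mul _), integral_const_mul,
            hW.integral_psi_sq hl hk]
          simp
          norm_num
  calc _ ≤ ∫ w, |W.psi l k w.1| * e w.2 ∂ν := by
        refine abs_integral_le_integral_abs.trans (integral_mono_ae (h4.sub h3).abs
          (hψ1.abs.mul_prod hei) ?_)
        have hfc' : ∀ᵐ w ∂ν, |f w.1| ≤ c := Measure.quasiMeasurePreserving_fst.ae hfc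
        filter_upwards [hfc'] with w hw
        rw [clippedProd, ← sub_mul, abs_mul, mul_comm]
        exact mul_le_mul_of_nonneg_left (abs_clip_sub_le hc ht hw) (abs_nonneg _)
    _ = (∫ x, |W.psi l k x|) * (2 * Real.exp (-t ^ 2 / 2)) := by
        rw [hν, integral_prod_mul (fun x => |W.psi l k x|) e, hee]
    _ ≤ _ := mul_le_of_le_one_left (by positivity) hψ

lemma empCoef_eq_sum (L : ℕ) (τ : ℝ) {n : ℕ} (z : Fin n → Obs) (a : indices l₀ L) :
    W.empCoef L τ z a = ∑ i, (1 / (n : ℝ)) * W.clippedProd τ a.1.1 a.1.2 (z i) := by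
  rw [empCoef, Finset.mul_sum]
  rfl

variable {W} in
/-- The mean squared error of the weighted empirical coefficients, before the privacy noise. -/
lemma lintegral_sum_empCoef_sub_sq_le {A : ℕ} (hW : W.IsRegularBasis A) {f : unitInterval → ℝ}
    (hf : AEMeasurable f volume) {L : ℕ} {τ : ℝ} (hτ : 0 ≤ τ) {m : ℕ} {n : Fin m → ℕ}
    (hn : ∀ j, 0 < n j) {u : Fin m → ℝ} (hu : ∑ j, u j = 1) (a : indices l₀ L) :
    ∫⁻ z, ENNReal.ofReal ((∑ j, u j * W.empCoef L τ (z j) a -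
        ∫ o, W.clippedProd τ a.1.1 a.1.2 o ∂obsLaw f) ^ 2) ∂dataLaw n f ≤
      ENNReal.ofReal (∑ j, u j ^ 2 * (τ ^ 2 / n j)) := by
  have := isProbabilityMeasure_obsLaw hf
  obtain ⟨ha1, ha2⟩ := mem_indices a
  set g := W.clippedProd τ a.1.1 a.1.2 with hg
  have hgL : MemLp g 2 (obsLaw f) := W.memLp_clippedProd hτ ha1 ha2 _
  have hnr : ∀ j, (n j : ℝ) ≠ 0 := fun j => by exact_mod_cast (hn j).ne'
  have hemp : ∀ j (z : Fin (n j) → Obs), W.empCoef L τ z a =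
      (∑ i, fun z : Fin (n j) → Obs => (1 / (n j : ℝ)) * g (z i)) z := fun j z => by
    rw [W.empCoef_eq_sum, Finset.sum_apply]
  have hgi : ∀ j (i : Fin (n j)), MemLp (fun z : Fin (n j) → Obs => (1 / (n j : ℝ)) * g (z i)) 2
      (Measure.pi fun _ : Fin (n j) => obsLaw f) := fun j i =>
    (hgL.comp_measurePreserving (measurePreserving_eval _ i)).const_mul _
  have hL : ∀ j, MemLp (fun z : Fin (n j) → Obs => u j * W.empCoef L τ z a) 2
      (Measure.pi fun _ : Fin (n j) => obsLaw f) := fun j => by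
    simp_rw [hemp]
    exact (memLp_finsetSum' _ fun i _ => hgi j i).const_mul _
  have hmean : ∀ j, ∫ z, u j * W.empCoef L τ z a ∂(Measure.pi fun _ : Fin (n j) => obsLaw f) =
      u j * ∫ o, g o ∂obsLaw f := fun j => by
    rw [integral_const_mul]
    congr 1
    simp_rw [hemp, Finset.sum_apply]
    rw [integral_finsetSum _ fun i _ => (hgi j i).integrable one_le_two]
    simp_rw [integral_const_mul]
    have h : ∀ i : Fin (n j), ∫ z : Fin (n j) → Obs, g (z i) ∂(Measure.pi fun _ => obsLaw f) =
        ∫ o, g o ∂obsLaw f := fun i => by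
      have hmp := measurePreserving_eval (fun _ : Fin (n j) => obsLaw f) i
      conv_rhs => rw [← hmp.map_eq]
      rw [integral_map hmp.measurable.aemeasurable (by rw [hmp.map_eq]; exact hgL.1)]
    simp_rw [h]
    rw [Finset.sum_const, Finset.card_univ, Fintype.card_fin, nsmul_eq_mul, ← mul_assoc,
      mul_one_div_cancel (hnr j), one_mul]
  have hvar : ∀ j, Var[fun z : Fin (n j) → Obs => u j * W.empCoef L τ z a;
      Measure.pi fun _ : Fin (n j) => obsLaw f] ≤ u j ^ 2 * (τ ^ 2 / n j) := fun j => by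
    rw [variance_const_mul]
    refine mul_le_mul_of_nonneg_left ?_ (sq_nonneg _)
    have h : (fun z : Fin (n j) → Obs => W.empCoef L τ z a) =
        ∑ i, fun z : Fin (n j) → Obs => (1 / (n j : ℝ)) * g (z i) := funext (hemp j)
    rw [h, variance_sum_pi (X := fun _ : Fin (n j) => fun o => (1 / (n j : ℝ)) * g o)
      fun i => hgL.const_mul _]
    simp_rw [variance_const_mul]
    rw [Finset.sum_const, Finset.card_univ, Fintype.card_fin, nsmul_eq_mul]
    calc _ ≤ (n j : ℝ) * ((1 / (n j : ℝ)) ^ 2 * τ ^ 2) := by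
          gcongr
          exact variance_clippedProd_le hW hf hτ ha1 ha2
      _ = _ := by have := hnr j; field_simp
  have hsum : ∑ j, ∫ z, u j * W.empCoef L τ z a ∂(Measure.pi fun _ : Fin (n j) => obsLaw f) =
      ∫ o, g o ∂obsLaw f := by
    simp_rw [hmean]
    rw [← Finset.sum_mul, hu, one_mul]
  have h := lintegral_sub_mean_sq_pi hL
  rw [hsum] at h
  exact h.trans_le (ENNReal.ofReal_le_ofReal (Finset.sum_le_sum fun j _ => hvar j))

lemma transcript_eq_pi (L : ℕ) (τ : ℝ) (n : ℕ) (ε δ : ℝ) (z : Fin n → Obs) :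
    W.transcript L τ n ε δ z =
      Measure.pi fun a => gaussianReal (W.empCoef L τ z a) (W.noiseVar L τ n ε δ) := by
  have := Measure.pi_map_pi (μ := fun _ : indices l₀ L => gaussianReal 0 (W.noiseVar L τ n ε δ))
    (f := fun a x => W.empCoef L τ z a + x) (fun i => by fun_prop)
  simp only [gaussianReal_map_const_add, zero_add] at this
  exact this

/-- The contribution of the privacy noise to the error, given the data. -/
lemma lintegral_sum_transcript_sub_sq (L : ℕ) (τ : ℝ) {m : ℕ} (n : Fin m → ℕ) (ε δ u : Fin m → ℝ)
    (z : (j : Fin m) → Fin (n j) → Obs) (a : indices l₀ L) :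
    ∫⁻ t, ENNReal.ofReal ((∑ j, u j * t j a - ∑ j, u j * W.empCoef L τ (z j) a) ^ 2)
        ∂(Measure.pi fun j => W.transcript L τ (n j) (ε j) (δ j) (z j)) =
      ENNReal.ofReal (∑ j, u j ^ 2 * W.noiseVar L τ (n j) (ε j) (δ j)) := by
  have hmp : ∀ j, MeasurePreserving (Function.eval a) (W.transcript L τ (n j) (ε j) (δ j) (z j))
      (gaussianReal (W.empCoef L τ (z j) a) (W.noiseVar L τ (n j) (ε j) (δ j))) := fun j => by
    rw [W.transcript_eq_pi]
    exact measurePreserving_eval _ a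
  have hid : ∀ j, MemLp (fun s : ℝ => s) 2
      (gaussianReal (W.empCoef L τ (z j) a) (W.noiseVar L τ (n j) (ε j) (δ j))) := fun j =>
    memLp_id_gaussianReal' 2 (by simp)
  have hL : ∀ j, MemLp (fun t : Transcript l₀ L => u j * t a) 2
      (W.transcript L τ (n j) (ε j) (δ j) (z j)) := fun j =>
    ((hid j).comp_measurePreserving (hmp j)).const_mul _
  have hmean : ∀ j, ∫ t : Transcript l₀ L, u j * t a ∂W.transcript L τ (n j) (ε j) (δ j) (z j) =
      u j * W.empCoef L τ (z j) a := fun j => by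
    rw [integral_const_mul]
    have h := integral_map (μ := W.transcript L τ (n j) (ε j) (δ j) (z j))
      (hmp j).measurable.aemeasurable (f := fun s : ℝ => s)
      aestronglyMeasurable_id
    rw [(hmp j).map_eq, integral_id_gaussianReal] at h
    exact congrArg _ h.symm
  have hvar : ∀ j, Var[fun t : Transcript l₀ L => u j * t a;
      W.transcript L τ (n j) (ε j) (δ j) (z j)] =
        u j ^ 2 * W.noiseVar L τ (n j) (ε j) (δ j) := fun j => by
    rw [variance_const_mul]
    have h := variance_map (X := fun s : ℝ => s) (Y := Function.eval a)
      (μ := W.transcript L τ (n j) (ε j) (δ j) (z j)) aemeasurable_id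
      (hmp j).measurable.aemeasurable
    rw [(hmp j).map_eq, variance_fun_id_gaussianReal] at h
    exact congrArg _ h.symm
  have h := lintegral_sub_mean_sq_pi hL
  simp_rw [hmean, hvar] at h
  exact h

end WaveletSystem

end FedWavelet

namespace FedWavelet

/-! ### The risk bound -/

lemma lintegral_add_sq_le {Ω : Type*} [MeasurableSpace Ω] {μ : Measure Ω} {F : Ω → ℝ} (G : Ω → ℝ)
    (hF : AEMeasurable F μ) :
    ∫⁻ ω, ENNReal.ofReal ((F ω + G ω) ^ 2) ∂μ ≤
      2 * ∫⁻ ω, ENNReal.ofReal (F ω ^ 2) ∂μ + 2 * ∫⁻ ω, ENNReal.ofReal (G ω ^ 2) ∂μ := by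
  rw [← lintegral_const_mul' 2 _ (by simp), ← lintegral_const_mul' 2 _ (by simp),
    ← lintegral_add_left' ((hF.pow_const 2).ennreal_ofReal.const_mul 2)]
  refine lintegral_mono fun ω => ?_
  have h2 : (2 : ℝ≥0∞) = ENNReal.ofReal 2 := by simp
  rw [h2, ← ENNReal.ofReal_mul (by norm_num), ← ENNReal.ofReal_mul (by norm_num),
    ← ENNReal.ofReal_add (by positivity) (by positivity)]
  refine ENNReal.ofReal_le_ofReal ?_
  nlinarith [sq_nonneg (F ω - G ω)]

namespace WaveletSystem

variable {l₀ : ℕ} {W : WaveletSystem l₀}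

/-- The weight `u_j` of server `j` in the central estimator. -/
noncomputable def weight (L : ℕ) {m : ℕ} (n : Fin m → ℕ) (ε : Fin m → ℝ) (j : Fin m) : ℝ :=
  rawWeight L (n j) (ε j) / ∑ i, rawWeight L (n i) (ε i)

/-- Bias-variance decomposition: for given transcripts, the loss is controlled by the error in the
coefficients of levels at most `L` and the approximation error. -/
lemma lintegral_estimator_sub_sq_le {A : ℕ} (hW : W.IsRegularBasis A) (f : unitInterval → ℝ)
    (L : ℕ) {m : ℕ} (n : Fin m → ℕ) (ε : Fin m → ℝ) (t : Fin m → Transcript l₀ L) :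
    ∫⁻ x, ENNReal.ofReal ((W.estimator L n ε t x - f x) ^ 2) ≤
      2 * ∑ a : indices l₀ L,
          ENNReal.ofReal ((∑ j, weight L n ε j * t j a - W.coef f a.1.1 a.1.2) ^ 2) +
        2 * ∫⁻ x, ENNReal.ofReal ((f x - W.proj f L x) ^ 2) := by
  have h1 : ∀ x, W.estimator L n ε t x - f x =
      ∑ a : indices l₀ L, (∑ j, weight L n ε j * t j a - W.coef f a.1.1 a.1.2) *
        W.psi a.1.1 a.1.2 x + -(f x - W.proj f L x) := fun x => by
    simp only [estimator, W.proj_eq_sum_indices, sub_mul, Finset.sum_sub_distrib, weight]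
    ring
  simp_rw [h1]
  refine (lintegral_add_sq_le _ ?_).trans ?_
  · exact (Finset.measurable_sum _ fun a _ => (W.measurable_psi _ _).const_mul _).aemeasurable
  rw [hW.lintegral_sum_sq (fun a : indices l₀ L => (a.1.1, a.1.2)) ?_ mem_indices fun a =>
    ∑ j, weight L n ε j * t j a - W.coef f a.1.1 a.1.2,
    ENNReal.ofReal_sum_of_nonneg fun _ _ => sq_nonneg _]
  · simp only [neg_sq, le_refl]
  · rintro ⟨⟨l, k⟩, _⟩ ⟨⟨l', k'⟩, _⟩ h
    simpa using h

/-- The risk in terms of the weights: each of the `2 ^ (L + 1)` coefficients contributes the variance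
of the privacy noise, the sampling variance and the squared clipping bias, and `B` bounds the squared
approximation error. -/
lemma risk_le {A : ℕ} (hW : W.IsRegularBasis A) {f : unitInterval → ℝ} (hf : MemLp f 2 volume)
    {L : ℕ} (hL : l₀ + 1 ≤ L) {c t : ℝ} (hc : 0 ≤ c) (ht : 1 ≤ t) (hfc : ∀ᵐ x, |f x| ≤ c)
    {m : ℕ} {n : Fin m → ℕ} (hn : ∀ j, 0 < n j) {ε : Fin m → ℝ} (δ : Fin m → ℝ)
    (hu : ∑ j, weight L n ε j = 1) {B : ℝ} (hB : 0 ≤ B)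
    (happ : ∫⁻ x, ENNReal.ofReal ((f x - W.proj f L x) ^ 2) ≤ ENNReal.ofReal B) :
    W.risk L (c + t) n ε δ f ≤
      ENNReal.ofReal (2 * (2 ^ (L + 1) *
        (2 * ∑ j, weight L n ε j ^ 2 * W.noiseVar L (c + t) (n j) (ε j) (δ j) +
          2 * (2 * ∑ j, weight L n ε j ^ 2 * ((c + t) ^ 2 / n j) +
            2 * (2 * Real.exp (-t ^ 2 / 2)) ^ 2))) + 2 * B) := by
  have hobs := isProbabilityMeasure_obsLaw hf.1.aemeasurable
  have hdata : IsProbabilityMeasure (dataLaw n f) := by unfold dataLaw; infer_instance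
  set u := weight L n ε with hu'
  set V := ∑ j, u j ^ 2 * W.noiseVar L (c + t) (n j) (ε j) (δ j) with hV
  set E := ∑ j, u j ^ 2 * ((c + t) ^ 2 / n j) with hE
  set b := 2 * Real.exp (-t ^ 2 / 2) with hb
  have hV0 : 0 ≤ V := Finset.sum_nonneg fun j _ => by positivity
  have hE0 : 0 ≤ E := Finset.sum_nonneg fun j _ => by positivity
  -- the mean of the coefficient `a`, given the data
  set M : indices l₀ L → ((j : Fin m) → Fin (n j) → Obs) → ℝ := fun a z =>
    ∑ j, u j * W.empCoef L (c + t) (z j) a with hM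
  have hMm : ∀ a, Measurable (M a) := fun a =>
    Finset.measurable_sum _ fun j _ => Measurable.const_mul ((measurable_pi_apply a).comp
      ((W.measurable_empCoef L (c + t) (n j)).comp (measurable_pi_apply j))) _
  have hcm : ∀ (a : indices l₀ L) (r : ℝ),
      Measurable fun s : Fin m → Transcript l₀ L => ∑ j, u j * s j a - r := fun a r =>
    have h (j : Fin m) : Measurable fun s : Fin m → Transcript l₀ L => s j a :=
      (measurable_pi_apply a).comp (measurable_pi_apply j)
    (Finset.measurable_sum _ fun j _ => (h j).const_mul (u j)).sub_const r
  have hin : ∀ a z, ∫⁻ s, ENNReal.ofReal ((∑ j, u j * s j a - W.coef f a.1.1 a.1.2) ^ 2)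
        ∂(Measure.pi fun j => W.transcript L (c + t) (n j) (ε j) (δ j) (z j)) ≤
      2 * ENNReal.ofReal V + 2 * ENNReal.ofReal ((M a z - W.coef f a.1.1 a.1.2) ^ 2) := by
    intro a z
    have h1 := lintegral_add_sq_le
      (μ := Measure.pi fun j => W.transcript L (c + t) (n j) (ε j) (δ j) (z j))
      (F := fun s => ∑ j, u j * s j a - M a z) (fun _ => M a z - W.coef f a.1.1 a.1.2)
      (hcm a _).aemeasurable
    simp only [sub_add_sub_cancel, lintegral_const, measure_univ, mul_one] at h1
    rwa [W.lintegral_sum_transcript_sub_sq] at h1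
  have hout : ∀ a, ∫⁻ z, ENNReal.ofReal ((M a z - W.coef f a.1.1 a.1.2) ^ 2) ∂dataLaw n f ≤
      2 * ENNReal.ofReal E + 2 * ENNReal.ofReal (b ^ 2) := by
    intro a
    obtain ⟨ha1, ha2⟩ := mem_indices a
    set μa := ∫ o, W.clippedProd (c + t) a.1.1 a.1.2 o ∂obsLaw f
    have h1 := lintegral_add_sq_le (μ := dataLaw n f) (F := fun z => M a z - μa)
      (fun _ => μa - W.coef f a.1.1 a.1.2) ((hMm a).sub_const _).aemeasurable
    simp only [sub_add_sub_cancel, lintegral_const, measure_univ, mul_one] at h1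
    refine h1.trans (add_le_add ?_ ?_)
    · exact mul_le_mul_right (lintegral_sum_empCoef_sub_sq_le hW hf.1.aemeasurable
        (by linarith) hn hu a) _
    · refine mul_le_mul_right (ENNReal.ofReal_le_ofReal ?_) _
      rw [← sq_abs]
      exact pow_le_pow_left₀ (abs_nonneg _)
        (abs_integral_clippedProd_sub_coef_le hW hf hc ht hfc ha1 ha2) 2
  have hgm : ∀ a, Measurable fun z => ENNReal.ofReal ((M a z - W.coef f a.1.1 a.1.2) ^ 2) :=
    fun a => (((hMm a).sub_const _).pow_const 2).ennreal_ofReal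
  calc W.risk L (c + t) n ε δ f
      ≤ ∫⁻ z, ∫⁻ s, (2 * ∑ a : indices l₀ L,
          ENNReal.ofReal ((∑ j, u j * s j a - W.coef f a.1.1 a.1.2) ^ 2) +
          2 * ENNReal.ofReal B)
          ∂(Measure.pi fun j => W.transcript L (c + t) (n j) (ε j) (δ j) (z j)) ∂(dataLaw n f) := by
        refine lintegral_mono fun z => lintegral_mono fun s => ?_
        exact (lintegral_estimator_sub_sq_le hW f L n ε s).trans (by gcongr)
    _ ≤ ∫⁻ z, (2 * ∑ a : indices l₀ L, (2 * ENNReal.ofReal V +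
          2 * ENNReal.ofReal ((M a z - W.coef f a.1.1 a.1.2) ^ 2)) + 2 * ENNReal.ofReal B)
          ∂(dataLaw n f) := by
        refine lintegral_mono fun z => ?_
        rw [lintegral_add_right _ measurable_const, lintegral_const, measure_univ, mul_one,
          lintegral_const_mul' _ _ (by simp), lintegral_finsetSum _ fun a _ =>
            ((hcm a _).pow_const 2).ennreal_ofReal]
        gcongr with a
        exact hin a z
    _ = 2 * ∑ a : indices l₀ L, (2 * ENNReal.ofReal V +
          2 * ∫⁻ z, ENNReal.ofReal ((M a z - W.coef f a.1.1 a.1.2) ^ 2) ∂(dataLaw n f)) +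
          2 * ENNReal.ofReal B := by
        rw [lintegral_add_right _ measurable_const, lintegral_const, measure_univ, mul_one,
          lintegral_const_mul' _ _ (by simp), lintegral_finsetSum _ fun a _ =>
            ((hgm a).const_mul 2).const_add _]
        congr 2
        refine Finset.sum_congr rfl fun a _ => ?_
        rw [lintegral_add_left measurable_const, lintegral_const, measure_univ, mul_one,
          lintegral_const_mul' _ _ (by simp)]
    _ ≤ 2 * ∑ a : indices l₀ L, (2 * ENNReal.ofReal V +
          2 * (2 * ENNReal.ofReal E + 2 * ENNReal.ofReal (b ^ 2))) + 2 * ENNReal.ofReal B := by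
        gcongr with a
        exact hout a
    _ = _ := by
        have h2 : (2 : ℝ≥0∞) = ENNReal.ofReal 2 := by simp
        have hcard : ((indices l₀ L).card : ℝ≥0∞) = ENNReal.ofReal (2 ^ (L + 1)) := by
          rw [card_indices hL, ENNReal.ofReal_pow (by norm_num)]
          push_cast
          simp
        rw [Finset.sum_const, Finset.card_univ, Fintype.card_coe, nsmul_eq_mul, hcard, h2,
          ← ENNReal.ofReal_mul (by positivity), ← ENNReal.ofReal_mul (by positivity),
          ← ENNReal.ofReal_mul (by positivity), ← ENNReal.ofReal_add (by positivity) (by positivity),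
          ← ENNReal.ofReal_mul (by positivity), ← ENNReal.ofReal_add (by positivity) (by positivity),
          ← ENNReal.ofReal_mul (by positivity), ← ENNReal.ofReal_mul (by positivity),
          ← ENNReal.ofReal_mul (by positivity), ← ENNReal.ofReal_add (by positivity) (by positivity)]

/-! ### The choice of the resolution level and of the weights -/

lemma rawWeight_pos (L : ℕ) {n : ℕ} (hn : 0 < n) {ε : ℝ} (hε : 0 < ε) : 0 < rawWeight L n ε := by
  have : (0 : ℝ) < n := by exact_mod_cast hn
  exact lt_min (by positivity) (by positivity)

variable (W) in
/-- With weights proportional to `v_j`, the variance of the privacy noise is of order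
`τ² log (2 / δ) 2 ^ L / ∑ v_j`. -/
lemma sum_weight_sq_mul_noiseVar_le (L : ℕ) (τ : ℝ) {m : ℕ} {n : Fin m → ℕ}
    (hn : ∀ j, 0 < n j) {ε δ : Fin m → ℝ} (hε : ∀ j, 0 < ε j) (hδ : ∀ j, 0 < δ j ∧ δ j ≤ 1) {ℓ : ℝ}
    (hℓ : ∀ j, Real.log (2 / δ j) ≤ ℓ) (hS : 0 < ∑ i, rawWeight L (n i) (ε i)) :
    ∑ j, weight L n ε j ^ 2 * W.noiseVar L τ (n j) (ε j) (δ j) ≤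
      4 * τ ^ 2 * W.cPsi ^ 2 * ℓ * (2 ^ L / ∑ i, rawWeight L (n i) (ε i)) := by
  set S := ∑ i, rawWeight L (n i) (ε i) with hSd
  calc _ ≤ ∑ j, 4 * τ ^ 2 * W.cPsi ^ 2 * ℓ * 2 ^ L / S ^ 2 * rawWeight L (n j) (ε j) := by
        refine Finset.sum_le_sum fun j _ => ?_
        have hnj : (0 : ℝ) < n j := by exact_mod_cast hn j
        have hεj := hε j
        have hv := rawWeight_pos L (hn j) (hε j)
        have hl0 : 0 ≤ Real.log (2 / δ j) :=
          Real.log_nonneg (by rw [le_div_iff₀ (hδ j).1]; linarith [(hδ j).2])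
        rw [W.coe_noiseVar L τ _ _ (hδ j).1 (hδ j).2, weight, ← hSd]
        have h1 : rawWeight L (n j) (ε j) / ((n j : ℝ) ^ 2 * ε j ^ 2) ≤ 1 :=
          (div_le_one (by positivity)).2 (min_le_left _ _)
        calc _ = 4 * τ ^ 2 * W.cPsi ^ 2 * Real.log (2 / δ j) * 2 ^ L / S ^ 2 *
              rawWeight L (n j) (ε j) *
              (rawWeight L (n j) (ε j) / ((n j : ℝ) ^ 2 * ε j ^ 2)) := by
              field_simp
          _ ≤ 4 * τ ^ 2 * W.cPsi ^ 2 * Real.log (2 / δ j) * 2 ^ L / S ^ 2 *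
              rawWeight L (n j) (ε j) * 1 := by gcongr
          _ ≤ 4 * τ ^ 2 * W.cPsi ^ 2 * ℓ * 2 ^ L / S ^ 2 * rawWeight L (n j) (ε j) := by
              rw [mul_one]
              gcongr
              exact hℓ j
    _ = _ := by
        rw [← Finset.mul_sum, ← hSd]
        field_simp

/-- With weights proportional to `v_j`, the sampling variance is of order `τ² 2 ^ L / ∑ v_j`. -/
lemma sum_weight_sq_mul_div_le (L : ℕ) (τ : ℝ) {m : ℕ} {n : Fin m → ℕ}
    (hn : ∀ j, 0 < n j) {ε : Fin m → ℝ} (hε : ∀ j, 0 < ε j)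
    (hS : 0 < ∑ i, rawWeight L (n i) (ε i)) :
    ∑ j, weight L n ε j ^ 2 * (τ ^ 2 / n j) ≤
      τ ^ 2 * (2 ^ L / ∑ i, rawWeight L (n i) (ε i)) := by
  set S := ∑ i, rawWeight L (n i) (ε i) with hSd
  calc _ ≤ ∑ j, τ ^ 2 * 2 ^ L / S ^ 2 * rawWeight L (n j) (ε j) := by
        refine Finset.sum_le_sum fun j _ => ?_
        have hnj : (0 : ℝ) < n j := by exact_mod_cast hn j
        have hv := rawWeight_pos L (hn j) (hε j)
        rw [weight, ← hSd]
        have h1 : rawWeight L (n j) (ε j) / ((n j : ℝ) * 2 ^ L) ≤ 1 :=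
          (div_le_one (by positivity)).2 (min_le_right _ _)
        calc _ = τ ^ 2 * 2 ^ L / S ^ 2 * rawWeight L (n j) (ε j) *
              (rawWeight L (n j) (ε j) / ((n j : ℝ) * 2 ^ L)) := by
              field_simp
          _ ≤ τ ^ 2 * 2 ^ L / S ^ 2 * rawWeight L (n j) (ε j) * 1 := by gcongr
          _ = _ := mul_one _
    _ = _ := by
        rw [← Finset.mul_sum, ← hSd]
        field_simp

end WaveletSystem

lemma succ_le_level (l₀ : ℕ) (D : ℝ) : l₀ + 1 ≤ level l₀ D := le_max_left _ _

lemma le_two_pow_level (l₀ : ℕ) {D : ℝ} (hD : 0 < D) : D ≤ 2 ^ level l₀ D := by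
  have h1 : Real.logb 2 D ≤ (level l₀ D : ℝ) :=
    (Nat.le_ceil _).trans (Nat.cast_le.2 (le_max_right _ _))
  rwa [Real.logb_le_iff_le_rpow (by norm_num) hD, Real.rpow_natCast] at h1

/-- If `D` is bounded below by `κ`, then `2 ^ L` is of the order of `D`. -/
lemma two_pow_level_le (l₀ : ℕ) {κ D : ℝ} (hκ : 0 < κ) (hD : κ ≤ D) :
    (2 : ℝ) ^ level l₀ D ≤ (2 + 2 ^ (l₀ + 1) / κ) * D := by
  have hD0 : 0 < D := hκ.trans_le hD
  have hbase : (2 : ℝ) ^ (l₀ + 1) ≤ 2 ^ (l₀ + 1) / κ * D := by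
    rw [div_mul_eq_mul_div, le_div_iff₀ hκ]
    gcongr
  have h0 : 0 ≤ (2 : ℝ) ^ (l₀ + 1) / κ * D := by positivity
  rw [add_mul, level]
  rcases le_total ⌈Real.logb 2 D⌉₊ (l₀ + 1) with h | h
  · rw [max_eq_left h]
    linarith
  · rw [max_eq_right h]
    have hpos : 0 < ⌈Real.logb 2 D⌉₊ := by omega
    have h2 := Nat.ceil_lt_add_one (Nat.ceil_pos.1 hpos).le
    have h3 : (2 : ℝ) ^ ⌈Real.logb 2 D⌉₊ ≤ 2 * D := by
      rw [← Real.rpow_natCast]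
      calc _ ≤ (2 : ℝ) ^ (Real.logb 2 D + 1) :=
            Real.rpow_le_rpow_of_exponent_le (by norm_num) h2.le
        _ = _ := by
            rw [Real.rpow_add (by norm_num), Real.rpow_logb (by norm_num) (by norm_num) hD0,
              Real.rpow_one, mul_comm]
    linarith

/-- The level is at most of the order of the logarithm of the total sample size. -/
lemma level_le (l₀ : ℕ) {D α N : ℝ} (hD : 0 < D) (hα : 0 ≤ α) (hN : 2 ≤ N)
    (h : D ^ (2 * α + 2) ≤ N * D) : (level l₀ D : ℝ) ≤ (l₀ + 3) * (Real.log N / Real.log 2) := by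
  have hl2 : 0 < Real.log 2 := Real.log_pos (by norm_num)
  have h1 : 1 ≤ Real.log N / Real.log 2 := by
    rw [one_le_div hl2]
    exact Real.log_le_log (by norm_num) hN
  set q := Real.log N / Real.log 2
  have hlo : (level l₀ D : ℝ) ≤ (l₀ + 1) + (q + 1) := by
    have h2 : (⌈Real.logb 2 D⌉₊ : ℝ) ≤ q + 1 := by
      rcases le_total D 1 with h1D | h1D
      · have : Real.logb 2 D ≤ 0 := Real.logb_nonpos (by norm_num) hD.le h1D
        rw [Nat.ceil_eq_zero.2 this]
        push_cast
        linarith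
      · have h3 : D ≤ N := by
          have h4 : D * D ≤ N * D := by
            refine le_trans ?_ h
            calc D * D = D ^ (2 : ℝ) := by rw [← sq, ← Real.rpow_natCast]; norm_num
              _ ≤ _ := Real.rpow_le_rpow_of_exponent_le h1D (by linarith)
          exact le_of_mul_le_mul_right h4 hD
        have h5 : Real.logb 2 D ≤ q :=
          div_le_div_of_nonneg_right (Real.log_le_log hD h3) hl2.le
        have h6 := Nat.ceil_lt_add_one (Real.logb_nonneg (b := 2) (by norm_num) h1D)
        linarith
    rw [level]
    push_cast
    exact max_le (by linarith) (by linarith [Nat.cast_nonneg (α := ℝ) l₀])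
  nlinarith [Nat.cast_nonneg (α := ℝ) l₀]

namespace WaveletSystem

variable {l₀ : ℕ} {W : WaveletSystem l₀}

/-- The balancing equation for `D` makes the variance term `2 ^ (2 L) / ∑ v_j` of the order of the
squared approximation error `2 ^ (-2 L α)`. -/
lemma two_pow_div_sum_rawWeight_le (l₀ : ℕ) {κ D α : ℝ} (hκ : 0 < κ) (hD : κ ≤ D) (hα : 0 ≤ α)
    {m : ℕ} {n : Fin m → ℕ} {ε : Fin m → ℝ}
    (hDeq : D ^ (2 * α + 2) = ∑ j, min ((n j : ℝ) ^ 2 * ε j ^ 2) ((n j : ℝ) * D)) :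
    (2 : ℝ) ^ level l₀ D * (2 ^ level l₀ D / ∑ j, rawWeight (level l₀ D) (n j) (ε j)) ≤
      (2 + 2 ^ (l₀ + 1) / κ) ^ (2 * α + 2) * (2 : ℝ) ^ (-2 * (level l₀ D : ℝ) * α) := by
  have hD0 : 0 < D := hκ.trans_le hD
  set L := level l₀ D
  set K := 2 + 2 ^ (l₀ + 1) / κ with hK
  have hK0 : 0 < K := by positivity
  have hS : D ^ (2 * α + 2) ≤ ∑ j, rawWeight L (n j) (ε j) := by
    rw [hDeq]
    refine Finset.sum_le_sum fun j _ => min_le_min_left _ ?_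
    gcongr
    exact le_two_pow_level l₀ hD0
  have h1 : ((2 : ℝ) ^ L) ^ (2 * α + 2) ≤ K ^ (2 * α + 2) * D ^ (2 * α + 2) := by
    rw [← Real.mul_rpow hK0.le hD0.le]
    exact Real.rpow_le_rpow (by positivity) (two_pow_level_le l₀ hκ hD) (by linarith)
  have hDp : 0 < D ^ (2 * α + 2) := by positivity
  calc _ ≤ (2 : ℝ) ^ L * (2 ^ L / D ^ (2 * α + 2)) := by gcongr
    _ = ((2 : ℝ) ^ L) ^ (2 * α + 2) * (2 : ℝ) ^ (-2 * (L : ℝ) * α) / D ^ (2 * α + 2) := by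
        rw [← mul_div_assoc]
        congr 1
        rw [← Real.rpow_natCast, ← Real.rpow_mul (by norm_num), ← Real.rpow_add (by norm_num),
          ← Real.rpow_add (by norm_num)]
        congr 1
        ring
    _ ≤ K ^ (2 * α + 2) * D ^ (2 * α + 2) * (2 : ℝ) ^ (-2 * (L : ℝ) * α) / D ^ (2 * α + 2) := by
        gcongr
    _ = _ := by field_simp

/-- The clipping bias, summed over all coefficients, is of the order of the squared approximation
error. -/
lemma two_pow_mul_exp_le (L : ℕ) {α : ℝ} (hα : 0 ≤ α) :
    (2 : ℝ) ^ L * (Real.exp (-√((2 * α + 1) * L) ^ 2 / 2)) ^ 2 ≤ (2 : ℝ) ^ (-2 * (L : ℝ) * α) := by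
  have h0 : 0 ≤ (2 * α + 1) * L := by positivity
  rw [Real.sq_sqrt h0, ← Real.exp_nat_mul]
  have h1 : Real.exp (((2 : ℕ) : ℝ) * (-((2 * α + 1) * L) / 2)) ≤ (2 : ℝ) ^ (-((2 * α + 1) * L)) := by
    rw [Real.rpow_def_of_pos (by norm_num)]
    refine Real.exp_le_exp.2 ?_
    have : Real.log 2 ≤ 1 := by linarith [Real.log_le_sub_one_of_pos (show (0 : ℝ) < 2 by norm_num)]
    push_cast
    nlinarith
  calc _ ≤ (2 : ℝ) ^ L * (2 : ℝ) ^ (-((2 * α + 1) * L)) := by gcongr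
    _ = _ := by
        rw [← Real.rpow_natCast, ← Real.rpow_add (by norm_num)]
        congr 1
        ring

/-- The constant of the risk bound. It depends on the wavelet system, the smoothness `α`, the radius
`R`, the bound `c` on the sup norm and the lower bound `κ` for `D` only. -/
noncomputable def riskConst (W : WaveletSystem l₀) (α R c κ : ℝ) : ℝ :=
  (32 * W.cPsi ^ 2 + 16 / Real.log 2) * (2 + 2 ^ (l₀ + 1) / κ) ^ (2 * α + 2) *
    ((2 * c ^ 2 + 2 * (2 * α + 1) * (l₀ + 3)) / Real.log 2) + (64 + 2 * R ^ 2) / Real.log 2 ^ 2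

lemma riskConst_pos {α R c κ : ℝ} (hα : 0 ≤ α) (hκ : 0 < κ) : 0 < W.riskConst α R c κ := by
  have hl2 : 0 < Real.log 2 := Real.log_pos (by norm_num)
  unfold riskConst
  positivity

lemma risk_le_riskConst {A : ℕ} (hW : W.IsRegularBasis A) {α R : ℝ} (hR : 0 < R) {p q : ℝ≥0∞}
    (hp : 2 ≤ p) (hq : 1 ≤ q) (hα : 1 / 2 < α - (p⁻¹).toReal) {c : ℝ} (hc : 0 < c)
    {f : unitInterval → ℝ} (hf : f ∈ W.besovBall α p q R) (hfc : ∀ᵐ x, |f x| ≤ c) {κ D : ℝ}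
    (hκ : 0 < κ) (hD : κ ≤ D) {m : ℕ} {n : Fin m → ℕ} {ε δ : Fin m → ℝ} (hn : ∀ j, 0 < n j)
    (hN : 2 ≤ ∑ j, n j) (hε : ∀ j, 0 < ε j) (hδ : ∀ j, 0 < δ j ∧ δ j ≤ 1)
    (hDeq : D ^ (2 * α + 2) = ∑ j, min ((n j : ℝ) ^ 2 * ε j ^ 2) ((n j : ℝ) * D)) :
    W.risk (level l₀ D) (threshold c α (level l₀ D)) n ε δ f ≤
      ENNReal.ofReal (W.riskConst α R c κ * Real.log ((∑ j, n j : ℕ) : ℝ) *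
        (2 : ℝ) ^ (-2 * (level l₀ D : ℝ) * α) * Real.log (2 / ⨅ j, δ j)) := by
  have hα2 : 1 / 2 ≤ α := by linarith [ENNReal.toReal_nonneg (a := p⁻¹)]
  have hα0 : 0 ≤ α := by linarith
  have hD0 : 0 < D := hκ.trans_le hD
  have hl2 : 0 < Real.log 2 := Real.log_pos (by norm_num)
  have hm : Nonempty (Fin m) := by
    by_contra h
    rw [not_nonempty_iff] at h
    simp at hN
  have hNr : (2 : ℝ) ≤ ((∑ j, n j : ℕ) : ℝ) := by exact_mod_cast hN
  set N := ((∑ j, n j : ℕ) : ℝ) with hNd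
  have hlevel := level_le l₀ (α := α) (N := N) hD0 hα0 hNr (by
    rw [hDeq, hNd]
    push_cast
    rw [Finset.sum_mul]
    exact Finset.sum_le_sum fun j _ => min_le_right _ _)
  have hL1 := succ_le_level l₀ D
  have hbal := two_pow_div_sum_rawWeight_le l₀ (n := n) (ε := ε) hκ hD hα0 hDeq
  set L := level l₀ D
  set ℓ := Real.log (2 / ⨅ j, δ j) with hℓd
  obtain ⟨j₀, hj₀⟩ := exists_eq_ciInf_of_finite (f := δ)
  have hδ' : 0 < ⨅ j, δ j := by rw [← hj₀]; exact (hδ j₀).1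
  have hℓ : ∀ j, Real.log (2 / δ j) ≤ ℓ := fun j => by
    have := ciInf_le (Set.finite_range δ).bddBelow j
    have h3 := (hδ j).1
    exact Real.log_le_log (by positivity) (by gcongr)
  have hℓ2 : Real.log 2 ≤ ℓ := by
    refine le_trans (Real.log_le_log (by norm_num) ?_) (hℓ j₀)
    rw [le_div_iff₀ (hδ j₀).1]
    linarith [(hδ j₀).2]
  have hS : 0 < ∑ i, rawWeight L (n i) (ε i) :=
    Finset.sum_pos (fun i _ => rawWeight_pos L (hn i) (hε i)) Finset.univ_nonempty
  have hu : ∑ j, weight L n ε j = 1 := by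
    simp only [weight]
    rw [← Finset.sum_div, div_self hS.ne']
  set t := √((2 * α + 1) * L) with ht
  have hLr : (1 : ℝ) ≤ L := by exact_mod_cast (show 1 ≤ L by omega)
  have ht1 : 1 ≤ t := by
    rw [ht, Real.one_le_sqrt]
    nlinarith
  have happ := W.lintegral_sub_proj_sq_le hW hf.1 hR.le hα2
    (W.abs_coef_le_half_pow hR hp hq hα hf) (W.sum_coef_sq_le hR hp hq hf)
    (show l₀ ≤ L by omega)
  have hbias := two_pow_mul_exp_le L hα0
  rw [← ht] at hbias
  set X := (2 : ℝ) ^ (-2 * (L : ℝ) * α) with hX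
  have hX0 : 0 < X := by positivity
  refine (risk_le hW hf.1 hL1 hc.le ht1 hfc hn δ hu (by positivity) happ).trans
    (ENNReal.ofReal_le_ofReal ?_)
  have hV := W.sum_weight_sq_mul_noiseVar_le L (c + t) hn hε hδ hℓ hS
  have hE := sum_weight_sq_mul_div_le L (c + t) hn hε hS
  set V := ∑ j, weight L n ε j ^ 2 * W.noiseVar L (c + t) (n j) (ε j) (δ j)
  set E := ∑ j, weight L n ε j ^ 2 * ((c + t) ^ 2 / n j)
  set Q := (2 : ℝ) ^ L / ∑ i, rawWeight L (n i) (ε i)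
  set K := (2 + 2 ^ (l₀ + 1) / κ) ^ (2 * α + 2) with hK
  have hK0 : 0 < K := by positivity
  set T := (2 * c ^ 2 + 2 * (2 * α + 1) * (l₀ + 3)) / Real.log 2 with hT
  have hT0 : 0 ≤ T := by positivity
  have hlogN : Real.log 2 ≤ Real.log N := Real.log_le_log (by norm_num) hNr
  set y := Real.log N
  -- the squared clipping threshold is of the order of `L`, hence of `log N`
  have hτ : (c + t) ^ 2 ≤ T * y := by
    have h1 : t ^ 2 = (2 * α + 1) * L := Real.sq_sqrt (by positivity)
    have h2 : (1 : ℝ) ≤ y / Real.log 2 := (one_le_div hl2).2 hlogN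
    calc (c + t) ^ 2 ≤ 2 * c ^ 2 + 2 * t ^ 2 := by nlinarith [sq_nonneg (c - t)]
      _ ≤ 2 * c ^ 2 * (y / Real.log 2) + 2 * ((2 * α + 1) * ((l₀ + 3) * (y / Real.log 2))) := by
          rw [h1]
          refine add_le_add (le_mul_of_one_le_right (by positivity) h2) ?_
          gcongr
      _ = _ := by rw [hT]; ring
  have hcp := sq_nonneg W.cPsi
  have hy0 : 0 < y := hl2.trans_le hlogN
  have hℓ0 : 0 < ℓ := hl2.trans_le hℓ2
  have h1V : 2 ^ L * V ≤ 4 * (T * y) * W.cPsi ^ 2 * ℓ * (K * X) := by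
    calc 2 ^ L * V ≤ 2 ^ L * (4 * (c + t) ^ 2 * W.cPsi ^ 2 * ℓ * Q) := by gcongr
      _ = 4 * (c + t) ^ 2 * W.cPsi ^ 2 * ℓ * (2 ^ L * Q) := by ring
      _ ≤ _ := by gcongr
  have h1E : 2 ^ L * E ≤ (T * y) * (K * X) := by
    calc 2 ^ L * E ≤ 2 ^ L * ((c + t) ^ 2 * Q) := by gcongr
      _ = (c + t) ^ 2 * (2 ^ L * Q) := by ring
      _ ≤ _ := by gcongr
  have hr1 : 1 ≤ ℓ / Real.log 2 := (one_le_div hl2).2 hℓ2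
  have hr2 : 1 ≤ y * ℓ / Real.log 2 ^ 2 := by
    rw [one_le_div (by positivity), sq]
    gcongr
  calc 2 * (2 ^ (L + 1) * (2 * V + 2 * (2 * E + 2 * (2 * Real.exp (-t ^ 2 / 2)) ^ 2))) +
        2 * (R ^ 2 * X)
      = 8 * (2 ^ L * V) + 16 * (2 ^ L * E) + 64 * (2 ^ L * Real.exp (-t ^ 2 / 2) ^ 2) +
        2 * R ^ 2 * X := by ring
    _ ≤ 8 * (4 * (T * y) * W.cPsi ^ 2 * ℓ * (K * X)) + 16 * ((T * y) * (K * X)) + 64 * X +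
        2 * R ^ 2 * X := by gcongr
    _ = 32 * W.cPsi ^ 2 * K * T * y * ℓ * X + 16 * K * T * y * X * 1 +
        (64 + 2 * R ^ 2) * X * 1 := by ring
    _ ≤ 32 * W.cPsi ^ 2 * K * T * y * ℓ * X + 16 * K * T * y * X * (ℓ / Real.log 2) +
        (64 + 2 * R ^ 2) * X * (y * ℓ / Real.log 2 ^ 2) := by gcongr
    _ = W.riskConst α R c κ * y * X * ℓ := by
        rw [riskConst, ← hK, ← hT]
        ring

end WaveletSystem

end FedWavelet

theorem mainTheorem2 {A l₀ : ℕ} (W : FedWavelet.WaveletSystem l₀) (hW : W.IsRegularBasis A)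
    (α R : ℝ) (hα : α < A) (hR : 0 < R) :
    (∃ C₀ : ℝ, 0 < C₀ ∧ ∀ p q : ℝ≥0∞, 2 ≤ p → 1 ≤ q → 1 / 2 < α - (p⁻¹).toReal →
      ∀ f ∈ W.besovBall α p q R, ∀ᵐ x, |f x| ≤ C₀) ∧
    ∀ Cα : ℝ, 0 < Cα → ∀ κ : ℝ, 0 < κ → ∃ C : ℝ, 0 < C ∧
      ∀ p q : ℝ≥0∞, 2 ≤ p → 1 ≤ q → 1 / 2 < α - (p⁻¹).toReal →
      (∀ f ∈ W.besovBall α p q R, ∀ᵐ x, |f x| ≤ Cα) →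
      ∀ (m : ℕ) (n : Fin m → ℕ) (ε δ : Fin m → ℝ) (D : ℝ),
        (∀ j, 0 < n j) → 2 ≤ ∑ j, n j → (∀ j, 0 < ε j) → (∀ j, 0 < δ j ∧ δ j ≤ 1) →
        0 < D → D ^ (2 * α + 2) = ∑ j, min ((n j : ℝ) ^ 2 * ε j ^ 2) ((n j : ℝ) * D) →
        (∀ j, ε j ≤ 2 * Real.log (2 / δ j) →
          FedWavelet.IsDP
            (W.transcript (FedWavelet.level l₀ D)
              (FedWavelet.threshold Cα α (FedWavelet.level l₀ D)) (n j) (ε j) (δ j))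
            (ε j) (δ j)) ∧
        (κ ≤ D →
          ⨆ f ∈ W.besovBall α p q R,
            W.risk (FedWavelet.level l₀ D)
              (FedWavelet.threshold Cα α (FedWavelet.level l₀ D)) n ε δ f ≤
          ENNReal.ofReal (C * Real.log ((∑ j, n j : ℕ) : ℝ) *
            (2 : ℝ) ^ (-2 * (FedWavelet.level l₀ D : ℝ) * α) * Real.log (2 / ⨅ j, δ j))) := by
  have hsn := W.supNorm_nonneg
  have hr : 0 < (1 - FedWavelet.WaveletSystem.ratio)⁻¹ :=
    inv_pos.2 (sub_pos.2 FedWavelet.WaveletSystem.ratio_lt_one)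
  refine ⟨⟨W.overlap * W.supNorm * 2 * R * (1 - FedWavelet.WaveletSystem.ratio)⁻¹ + 1,
    by positivity, fun p q hp hq hpα f hf => ?_⟩, fun Cα hC κ hκ => ?_⟩
  · filter_upwards [W.ae_abs_le_of_coef_le hW hf.1 hR.le
      (W.abs_coef_le_half_pow hR hp hq hpα hf)] with x hx
    linarith
  -- for negative `α` the condition `1 / 2 < α - 1 / p` fails, and any constant will do
  by_cases hα0 : 0 ≤ α
  · refine ⟨W.riskConst α R Cα κ, FedWavelet.WaveletSystem.riskConst_pos hα0 hκ, ?_⟩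
    intro p q hp hq hpα hb m n ε δ D hn hN hε hδ _ hDeq
    refine ⟨fun j hj => ?_, fun hκD => iSup₂_le fun f hf => ?_⟩
    · exact W.isDP_transcript (FedWavelet.succ_le_level l₀ D)
        (add_nonneg hC.le (Real.sqrt_nonneg _)) (hn j) (hε j) (hδ j).1 (hδ j).2 hj
    · exact FedWavelet.WaveletSystem.risk_le_riskConst hW hR hp hq hpα hC hf (hb f hf) hκ hκD hn hN
        hε hδ hDeq
  · refine ⟨1, one_pos, fun p q _ _ hpα => ?_⟩
    linarith [ENNReal.toReal_nonneg (a := p⁻¹)]
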